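/- Work in Minkowski space of spacetime dimension at least three, and let $\mathcal K$ be the set of its double cones; $\mathcal O'$ denotes the causal complement of $\mathcal O$. A net $\mathfrak A$ assigns to each $\mathcal O\in\mathcal K$ a unital $C^*$-subalgebra $\mathfrak A(\mathcal O)$ of a unital $C^*$-algebra, also denoted $\mathfrak A$, such that $\mathcal O_1\subset\mathcal O_2$ implies $\mathfrak A(\mathcal O_1)\subset\mathfrak A(\mathcal O_2)$ and $\bigcup_{\mathcal O}\mathfrak A(\mathcal O)$ is norm dense in $\mathfrak A$. It satisfies relative duality if, for every $\mathcal O\in\mathcal K$, $\mathfrak A(\mathcal O)$ is the set of all $A\in\mathfrak A$ commuting with $\mathfrak A(\mathcal O_1)$ for every $\mathcal O_1\subset\mathcal O'$. An inclusion of nets $\mathfrak A\subset\mathfrak B$ is an injective unital $*$-homomorphism of the generated $C^*$-algebras mapping $\mathfrak A(\mathcal O)$ into $\mathfrak B(\mathcal O)$ for all $\mathcal O$. A unital $*$-endomorphism $\rho$ of $\mathfrak A$ is localized in $\mathcal O$ if $\rho(A)=A$ for $A\in\mathfrak A(\mathcal O_1)$, $\mathcal O_1\subset\mathcal O'$; it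 is transportable if for each $\mathcal O$ it is equivalent, by a unitary of $\mathfrak A$, to an endomorphism localized in $\mathcal O$. $\mathcal T_t(\mathfrak A)$ is the category of localized (in some double cone) transportable endomorphisms, with arrows $(\rho,\sigma)=\{T\in\mathfrak A: T\rho(A)=\sigma(A)T,\ A\in\mathfrak A\}$, with adjoint, linear structure and norm inherited from $\mathfrak A$, and with the strict tensor product $\rho\otimes\sigma=\rho\sigma$, $S\otimes T=S\rho(T)$ for $S\in(\rho,\rho')$, $T\in(\sigma,\sigma')$. Its canonical permutation symmetry is $\varepsilon(\rho,\sigma)=(U_2\otimes U_1)^*(U_1\otimes U_2)$ for any unitaries $U_1\in(\rho,\rho_1)$, $U_2\in(\sigma,\sigma_2)$ with $\rho_1,\sigma_2$ in $\mathcal T_t(\mathfrak A)$ localized in spacelike separated double cones. A $1$-simplex $b$ consists of a double cone $|b|$ (the support) and two double cones $\partial_0b,\partial_1b\subset|b|$ (the faces). A $2$-simplex $c$ consists of double cones $\mathcal O\supset\mathcal O_0\cup\mathcal O_1\cup\mathcal O_2$ and $\mathcal O_{01},\mathcal O_{02},\mathcal O_{12}$ such that $\partial_0c=(\mathcal O_0,\mathcal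 O_{01},\mathcal O_{02})$, $\partial_1c=(\mathcal O_1,\mathcal O_{01},\mathcal O_{12})$, $\partial_2c=(\mathcal O_2,\mathcal O_{02},\mathcal O_{12})$ are $1$-simplices (support, $\partial_0$, $\partial_1$). A $1$-cocycle of $\mathfrak A$ is a map $z$ from $1$-simplices to unitaries of $\mathfrak A$ with $z(b)\in\mathfrak A(|b|)$ and $z(\partial_0c)z(\partial_2c)=z(\partial_1c)$. The endomorphism $\rho_a$ which $z$ defines at $a\in\mathcal K$ is given by $\rho_a(A)=z(b)Az(b)^*$ for $A\in\mathfrak A(\mathcal O)$, $\partial_0b=a$, $\partial_1b\subset\mathcal O'$. **Theorem.** Let $\mathfrak A\subset\mathfrak B$ be an inclusion of nets satisfying relative duality. Then every $1$-cocycle of $\mathfrak A$ defines, at every $a\in\mathcal K$, an object of $\mathcal T_t(\mathfrak A)$ localized in $a$; every object of $\mathcal T_t(\mathfrak A)$ localized in $a$ arises in this way; the canonical permutation symmetries of $\mathcal T_t(\mathfrak A)$ and $\mathcal T_t(\mathfrak B)$ exist; and there is a functor $F:\mathcal T_t(\mathfrak A)\to\mathcal T_t(\mathfrak B)$ such that: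 1. $F(\rho)$ extends $\rho$, and whenever $\rho$ is defined at $a$ by a $1$-cocycle $z$ of $\mathfrak A$, $F(\rho)$ is the endomorphism of $\mathfrak B$ defined at $a$ by $z$ regarded as a $1$-cocycle of $\mathfrak B$; if $\rho$ is localized in $a$, so is $F(\rho)$. 2. $F(T)=T$ for every intertwiner $T$, i.e. $F$ is the given inclusion $\mathfrak A\subset\mathfrak B$ on arrows. 3. $F$ is injective on objects, faithful, $\mathbb C$-linear, isometric on spaces of arrows, and commutes with adjoints. 4. $F$ strictly preserves the tensor product and the tensor unit: $F(\rho\otimes\sigma)=F(\rho)\otimes F(\sigma)$, $F(\mathrm{id}_{\mathfrak A})=\mathrm{id}_{\mathfrak B}$, $F(S\otimes T)=F(S)\otimes F(T)$. 5. $F$ preserves the permutation symmetry: $F(\varepsilon_{\mathfrak A}(\rho,\sigma))=\varepsilon_{\mathfrak B}(F(\rho),F(\sigma))$. -/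

import Mathlib

open CategoryTheory MonoidalCategory

universe u v

noncomputable section

/-! ### Minkowski space and double cones -/

/-- Minkowski space with one time and `s` space dimensions; a point is a pair (time, position). -/
abbrev Minkowski (s : ℕ) : Type := ℝ × EuclideanSpace ℝ (Fin s)

namespace Minkowski

variable {s : ℕ}

/-- `x` lies in the open forward light cone. -/
def InForwardCone (x : Minkowski s) : Prop := ‖x.2‖ < x.1

/-- `x` and `y` are spacelike separated. -/
def Spacelike (x y : Minkowski s) : Prop := |x.1 - y.1| < ‖x.2 - y.2‖

/-- The causal (spacelike) complement `S'` of a region `S`. -/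
def causalComplement (S : Set (Minkowski s)) : Set (Minkowski s) :=
  {x | ∀ y ∈ S, Spacelike x y}

theorem InForwardCone.add {x y : Minkowski s} (hx : InForwardCone x) (hy : InForwardCone y) :
    InForwardCone (x + y) := by
  unfold InForwardCone at *
  have := norm_add_le x.2 y.2
  simp only [Prod.snd_add, Prod.fst_add]
  linarith

end Minkowski

open Minkowski

/-- A double cone, given by its past and future vertices. -/
structure DoubleCone (s : ℕ) where
  past : Minkowski s
  future : Minkowski s
  timelike : InForwardCone (future - past)

namespace DoubleCone

variable {s : ℕ}

/-- The region of the double cone: the intersection of the open forward light cone at the past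
vertex with the open backward light cone at the future vertex. -/
def region (O : DoubleCone s) : Set (Minkowski s) :=
  {x | InForwardCone (x - O.past) ∧ InForwardCone (O.future - x)}

/-- `O₁ ⊆ O₂`. -/
def Sub (O₁ O₂ : DoubleCone s) : Prop := O₁.region ⊆ O₂.region

/-- `O₁ ⊆ O₂'`, where `O₂'` is the causal complement of `O₂`. -/
def SpacelikeTo (O₁ O₂ : DoubleCone s) : Prop := O₁.region ⊆ causalComplement O₂.region

theorem Sub.refl (O : DoubleCone s) : O.Sub O := Set.Subset.refl _

theorem Sub.trans {O₁ O₂ O₃ : DoubleCone s} (h : O₁.Sub O₂) (h' : O₂.Sub O₃) : O₁.Sub O₃ :=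
  Set.Subset.trans h h'

theorem SpacelikeTo.mono {O O₁ O₂ : DoubleCone s} (h : O.SpacelikeTo O₂) (h' : O₁.Sub O₂) :
    O.SpacelikeTo O₁ := fun _ hx y hy => h hx y (h' hy)

/-- Double cones are directed under inclusion. -/
theorem exists_sup (O₁ O₂ : DoubleCone s) : ∃ O : DoubleCone s, O₁.Sub O ∧ O₂.Sub O := by
  set T : ℝ := |O₁.past.1| + ‖O₁.past.2‖ + |O₁.future.1| + ‖O₁.future.2‖
    + |O₂.past.1| + ‖O₂.past.2‖ + |O₂.future.1| + ‖O₂.future.2‖ + 1 with hT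
  have a1 := neg_abs_le O₁.past.1
  have a2 := le_abs_self O₁.future.1
  have a3 := neg_abs_le O₂.past.1
  have a4 := le_abs_self O₂.future.1
  have b1 := norm_nonneg O₁.past.2
  have b2 := norm_nonneg O₁.future.2
  have b3 := norm_nonneg O₂.past.2
  have b4 := norm_nonneg O₂.future.2
  have c1 := abs_nonneg O₁.past.1
  have c2 := abs_nonneg O₁.future.1
  have c3 := abs_nonneg O₂.past.1
  have c4 := abs_nonneg O₂.future.1
  have d1 : InForwardCone (O₁.past - ((-T, 0) : Minkowski s)) := by
    simp only [InForwardCone, Prod.fst_sub, Prod.snd_sub, sub_zero]; linarith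
  have d2 : InForwardCone (((T, 0) : Minkowski s) - O₁.future) := by
    simp only [InForwardCone, Prod.fst_sub, Prod.snd_sub, zero_sub, norm_neg]; linarith
  have d3 : InForwardCone (O₂.past - ((-T, 0) : Minkowski s)) := by
    simp only [InForwardCone, Prod.fst_sub, Prod.snd_sub, sub_zero]; linarith
  have d4 : InForwardCone (((T, 0) : Minkowski s) - O₂.future) := by
    simp only [InForwardCone, Prod.fst_sub, Prod.snd_sub, zero_sub, norm_neg]; linarith
  refine ⟨⟨(-T, 0), (T, 0), ?_⟩, fun x hx => ⟨?_, ?_⟩, fun x hx => ⟨?_, ?_⟩⟩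
  · simp only [InForwardCone, Prod.fst_sub, Prod.snd_sub, sub_zero, norm_zero]; linarith
  · simpa using hx.1.add d1
  · simpa using d2.add hx.2
  · simpa using hx.1.add d3
  · simpa using d4.add hx.2

end DoubleCone

/-! ### Simplices of the partially ordered set of double cones -/

/-- A `1`-simplex `b`: a support `|b|` and two faces `∂₀b`, `∂₁b` contained in it. -/
structure OneSimplex (s : ℕ) where
  support : DoubleCone s
  face0 : DoubleCone s
  face1 : DoubleCone s
  sub0 : face0.Sub support
  sub1 : face1.Sub support

/-- A `2`-simplex `c = (O, O₀, O₁, O₂, O₀₁, O₀₂, O₁₂)`. -/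
structure TwoSimplex (s : ℕ) where
  support : DoubleCone s
  o0 : DoubleCone s
  o1 : DoubleCone s
  o2 : DoubleCone s
  o01 : DoubleCone s
  o02 : DoubleCone s
  o12 : DoubleCone s
  sub0 : o0.Sub support
  sub1 : o1.Sub support
  sub2 : o2.Sub support
  sub01_0 : o01.Sub o0
  sub02_0 : o02.Sub o0
  sub01_1 : o01.Sub o1
  sub12_1 : o12.Sub o1
  sub02_2 : o02.Sub o2
  sub12_2 : o12.Sub o2

namespace TwoSimplex

variable {s : ℕ}

/-- `∂₀c = (O₀, O₀₁, O₀₂)`. -/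
def face0 (c : TwoSimplex s) : OneSimplex s := ⟨c.o0, c.o01, c.o02, c.sub01_0, c.sub02_0⟩

/-- `∂₁c = (O₁, O₀₁, O₁₂)`. -/
def face1 (c : TwoSimplex s) : OneSimplex s := ⟨c.o1, c.o01, c.o12, c.sub01_1, c.sub12_1⟩

/-- `∂₂c = (O₂, O₀₂, O₁₂)`. -/
def face2 (c : TwoSimplex s) : OneSimplex s := ⟨c.o2, c.o02, c.o12, c.sub02_2, c.sub12_2⟩

end TwoSimplex

/-! ### Nets of C*-algebras -/

/-- A net of unital C*-algebras over the double cones, generating the C*-algebra `𝔄`. -/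
structure Net (s : ℕ) (𝔄 : Type u) [CStarAlgebra 𝔄] where
  alg : DoubleCone s → StarSubalgebra ℂ 𝔄
  isClosed : ∀ O, IsClosed (alg O : Set 𝔄)
  mono : ∀ {O₁ O₂}, O₁.Sub O₂ → alg O₁ ≤ alg O₂
  dense : Dense (⋃ O, (alg O : Set 𝔄))

namespace Net

variable {s : ℕ} {𝔄 : Type u} [CStarAlgebra 𝔄] {𝔅 : Type v} [CStarAlgebra 𝔅]

/-- Relative duality: `𝔄(O) = 𝔄(O')' ∩ 𝔄`, where `𝔄(O')` is generated by the `𝔄(O₁)` with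
`O₁ ⊆ O'`. -/
def RelativeDuality (N : Net s 𝔄) : Prop :=
  ∀ O, (N.alg O : Set 𝔄) =
    {A | ∀ O₁ : DoubleCone s, O₁.SpacelikeTo O → ∀ B ∈ N.alg O₁, A * B = B * A}

/-- An inclusion of nets: an injective unital *-homomorphism of the generated C*-algebras that
maps `𝔄(O)` into `𝔅(O)`. -/
structure Inclusion (A : Net s 𝔄) (B : Net s 𝔅) where
  hom : 𝔄 →⋆ₐ[ℂ] 𝔅
  injective : Function.Injective hom
  map_mem : ∀ O, ∀ x ∈ A.alg O, hom x ∈ B.alg O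

/-- The endomorphism `ρ` is localized in `O`: it is the identity on `𝔄(O₁)` for `O₁ ⊆ O'`. -/
def LocalizedIn (N : Net s 𝔄) (ρ : 𝔄 →⋆ₐ[ℂ] 𝔄) (O : DoubleCone s) : Prop :=
  ∀ O₁ : DoubleCone s, O₁.SpacelikeTo O → ∀ A ∈ N.alg O₁, ρ A = A

/-- The endomorphism `ρ` is transportable: for every double cone `O` it is inner equivalent to
an endomorphism localized in `O`. -/
def Transportable (N : Net s 𝔄) (ρ : 𝔄 →⋆ₐ[ℂ] 𝔄) : Prop :=
  ∀ O : DoubleCone s, ∃ σ : 𝔄 →⋆ₐ[ℂ] 𝔄, N.LocalizedIn σ O ∧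
    ∃ U ∈ unitary 𝔄, ∀ A, U * ρ A = σ A * U

theorem LocalizedIn.mono {N : Net s 𝔄} {ρ : 𝔄 →⋆ₐ[ℂ] 𝔄} {O₁ O₂ : DoubleCone s}
    (h : N.LocalizedIn ρ O₁) (hO : O₁.Sub O₂) : N.LocalizedIn ρ O₂ :=
  fun O hO' A hA => h O (hO'.mono hO) A hA

theorem LocalizedIn.comp {N : Net s 𝔄} {ρ σ : 𝔄 →⋆ₐ[ℂ] 𝔄} {O : DoubleCone s}
    (hρ : N.LocalizedIn ρ O) (hσ : N.LocalizedIn σ O) : N.LocalizedIn (ρ.comp σ) O := by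
  intro O₁ hO A hA
  rw [StarAlgHom.comp_apply, hσ O₁ hO A hA, hρ O₁ hO A hA]

theorem Transportable.comp {N : Net s 𝔄} {ρ σ : 𝔄 →⋆ₐ[ℂ] 𝔄}
    (hρ : N.Transportable ρ) (hσ : N.Transportable σ) : N.Transportable (ρ.comp σ) := by
  intro O
  obtain ⟨ρ', hρ', U, hU, hUρ⟩ := hρ O
  obtain ⟨σ', hσ', V, hV, hVσ⟩ := hσ O
  refine ⟨ρ'.comp σ', hρ'.comp hσ', U * ρ V, mul_mem hU (Unitary.map_mem ρ hV), fun A => ?_⟩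
  rw [StarAlgHom.comp_apply, StarAlgHom.comp_apply, mul_assoc, ← map_mul, hVσ, map_mul,
    ← mul_assoc, hUρ, mul_assoc]

/-! ### The category of localized transportable endomorphisms -/

/-- An object of `𝒯_t(𝔄)`: a localized and transportable endomorphism of `𝔄`. -/
@[ext]
structure Tt (N : Net s 𝔄) where
  endo : 𝔄 →⋆ₐ[ℂ] 𝔄
  localized : ∃ O, N.LocalizedIn endo O
  transportable : N.Transportable endo

namespace Tt

variable {N : Net s 𝔄}

/-- An arrow from `ρ` to `σ` in `𝒯_t(𝔄)`: an intertwiner `T ∈ 𝔄`, `T ρ(A) = σ(A) T`. -/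
@[ext]
structure Hom (ρ σ : Tt N) where
  val : 𝔄
  intertwines : ∀ A, val * ρ.endo A = σ.endo A * val

instance : Category (Tt N) where
  Hom ρ σ := Hom ρ σ
  id ρ := ⟨1, fun A => by rw [one_mul, mul_one]⟩
  comp f g := ⟨g.val * f.val, fun A => by
    rw [mul_assoc, f.intertwines, ← mul_assoc, g.intertwines, mul_assoc]⟩
  id_comp f := Hom.ext (mul_one f.val)
  comp_id f := Hom.ext (one_mul f.val)
  assoc f g h := Hom.ext (mul_assoc h.val g.val f.val).symm

/-- The element of `𝔄` underlying an arrow. -/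
def elem {ρ σ : Tt N} (f : ρ ⟶ σ) : 𝔄 := Hom.val f

/-- The arrow given by an intertwiner. -/
def ofElem {ρ σ : Tt N} (T : 𝔄) (h : ∀ A, T * ρ.endo A = σ.endo A * T) : ρ ⟶ σ := ⟨T, h⟩

theorem elem_intertwines {ρ σ : Tt N} (f : ρ ⟶ σ) (A : 𝔄) :
    elem f * ρ.endo A = σ.endo A * elem f := Hom.intertwines f A

theorem elem_injective {ρ σ : Tt N} : Function.Injective (elem : (ρ ⟶ σ) → 𝔄) :=
  fun _ _ h => Hom.ext h

theorem hom_ext {ρ σ : Tt N} {f g : ρ ⟶ σ} (h : elem f = elem g) : f = g := elem_injective h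

@[simp] theorem elem_ofElem {ρ σ : Tt N} (T : 𝔄) (h : ∀ A, T * ρ.endo A = σ.endo A * T) :
    elem (ofElem T h : ρ ⟶ σ) = T := rfl

@[simp] theorem elem_id (ρ : Tt N) : elem (𝟙 ρ) = 1 := rfl

@[simp] theorem elem_comp {ρ σ τ : Tt N} (f : ρ ⟶ σ) (g : σ ⟶ τ) :
    elem (f ≫ g) = elem g * elem f := rfl

/-! The linear structure, the adjoint and the norm on the spaces of intertwiners are those
inherited from `𝔄`. -/

instance (ρ σ : Tt N) : Zero (ρ ⟶ σ) := ⟨ofElem 0 fun A => by simp⟩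

instance (ρ σ : Tt N) : Add (ρ ⟶ σ) :=
  ⟨fun f g => ofElem (elem f + elem g) fun A => by
    rw [add_mul, mul_add, elem_intertwines, elem_intertwines]⟩

instance (ρ σ : Tt N) : Neg (ρ ⟶ σ) :=
  ⟨fun f => ofElem (-elem f) fun A => by rw [neg_mul, mul_neg, elem_intertwines]⟩

instance (ρ σ : Tt N) : Sub (ρ ⟶ σ) :=
  ⟨fun f g => ofElem (elem f - elem g) fun A => by
    rw [sub_mul, mul_sub, elem_intertwines, elem_intertwines]⟩

instance (ρ σ : Tt N) : SMul ℕ (ρ ⟶ σ) :=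
  ⟨fun n f => ofElem (n • elem f) fun A => by
    rw [smul_mul_assoc, mul_smul_comm, elem_intertwines]⟩

instance (ρ σ : Tt N) : SMul ℤ (ρ ⟶ σ) :=
  ⟨fun n f => ofElem (n • elem f) fun A => by
    rw [smul_mul_assoc, mul_smul_comm, elem_intertwines]⟩

instance (ρ σ : Tt N) : SMul ℂ (ρ ⟶ σ) :=
  ⟨fun n f => ofElem (n • elem f) fun A => by
    rw [smul_mul_assoc, mul_smul_comm, elem_intertwines]⟩

instance (ρ σ : Tt N) : AddCommGroup (ρ ⟶ σ) :=
  Function.Injective.addCommGroup elem elem_injective rfl (fun _ _ => rfl) (fun _ => rfl)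
    (fun _ _ => rfl) (fun _ _ => rfl) (fun _ _ => rfl)

@[simp] theorem elem_add {ρ σ : Tt N} (f g : ρ ⟶ σ) : elem (f + g) = elem f + elem g := rfl

@[simp] theorem elem_smul {ρ σ : Tt N} (c : ℂ) (f : ρ ⟶ σ) : elem (c • f) = c • elem f := rfl

instance : Preadditive (Tt N) where
  add_comp _ _ _ f f' g := hom_ext (by simp only [elem_comp, elem_add, mul_add])
  comp_add _ _ _ f g g' := hom_ext (by simp only [elem_comp, elem_add, add_mul])

instance (ρ σ : Tt N) : Module ℂ (ρ ⟶ σ) :=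
  Function.Injective.module ℂ (⟨⟨elem, rfl⟩, fun _ _ => rfl⟩ : (ρ ⟶ σ) →+ 𝔄) elem_injective
    (fun _ _ => rfl)

instance : Linear ℂ (Tt N) where
  homModule _ _ := inferInstance
  smul_comp _ _ _ r f g := hom_ext (mul_smul_comm r (elem g) (elem f))
  comp_smul _ _ _ f r g := hom_ext (smul_mul_assoc r (elem g) (elem f))

/-- The adjoint `T* ∈ (σ, ρ)` of an intertwiner `T ∈ (ρ, σ)`. -/
def adjoint {ρ σ : Tt N} (f : ρ ⟶ σ) : σ ⟶ ρ :=
  ofElem (star (elem f)) fun A => by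
    have h := congrArg star (elem_intertwines f (star A))
    simpa [map_star] using h.symm

instance (ρ σ : Tt N) : Norm (ρ ⟶ σ) := ⟨fun f => ‖elem f‖⟩

/-- The tensor product: composition of endomorphisms on objects, and
`S ⊗ T = S ρ(T)` for `S ∈ (ρ, ρ')` and `T ∈ (σ, σ')` on arrows. -/
instance : MonoidalCategoryStruct (Tt N) where
  tensorObj ρ σ :=
    { endo := ρ.endo.comp σ.endo
      localized := by
        obtain ⟨O₁, h₁⟩ := ρ.localized
        obtain ⟨O₂, h₂⟩ := σ.localized
        obtain ⟨O, hO₁, hO₂⟩ := DoubleCone.exists_sup O₁ O₂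
        exact ⟨O, (h₁.mono hO₁).comp (h₂.mono hO₂)⟩
      transportable := ρ.transportable.comp σ.transportable }
  whiskerLeft ρ _ _ g := ofElem (ρ.endo (elem g)) fun A => by
    simp only [StarAlgHom.comp_apply]
    rw [← map_mul, elem_intertwines, map_mul]
  whiskerRight f σ := ofElem (elem f) fun A => elem_intertwines f (σ.endo A)
  tensorHom {ρ ρ' σ σ'} f g := ofElem (elem f * ρ.endo (elem g)) fun A => by
    simp only [StarAlgHom.comp_apply]
    rw [mul_assoc, ← map_mul, elem_intertwines, elem_intertwines, elem_intertwines, map_mul,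
      mul_assoc]
  tensorUnit :=
    { endo := StarAlgHom.id ℂ 𝔄
      localized := ⟨⟨0, (1, 0), by simp [InForwardCone]⟩, fun _ _ _ _ => rfl⟩
      transportable := fun _ => ⟨StarAlgHom.id ℂ 𝔄, fun _ _ _ _ => rfl, 1, one_mem _,
        fun A => by simp⟩ }
  associator ρ σ τ :=
    { hom := ofElem 1 fun A => by rw [one_mul, mul_one]; rfl
      inv := ofElem 1 fun A => by rw [one_mul, mul_one]; rfl
      hom_inv_id := hom_ext (mul_one (1 : 𝔄))
      inv_hom_id := hom_ext (mul_one (1 : 𝔄)) }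
  leftUnitor ρ :=
    { hom := ofElem 1 fun A => by rw [one_mul, mul_one]; rfl
      inv := ofElem 1 fun A => by rw [one_mul, mul_one]; rfl
      hom_inv_id := hom_ext (mul_one (1 : 𝔄))
      inv_hom_id := hom_ext (mul_one (1 : 𝔄)) }
  rightUnitor ρ :=
    { hom := ofElem 1 fun A => by rw [one_mul, mul_one]; rfl
      inv := ofElem 1 fun A => by rw [one_mul, mul_one]; rfl
      hom_inv_id := hom_ext (mul_one (1 : 𝔄))
      inv_hom_id := hom_ext (mul_one (1 : 𝔄)) }

@[simp] theorem endo_tensor (ρ σ : Tt N) : (ρ ⊗ σ).endo = ρ.endo.comp σ.endo := rfl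

@[simp] theorem endo_unit : (𝟙_ (Tt N)).endo = StarAlgHom.id ℂ 𝔄 := rfl

@[simp] theorem elem_tensorHom {ρ ρ' σ σ' : Tt N} (f : ρ ⟶ ρ') (g : σ ⟶ σ') :
    elem (f ⊗ₘ g) = elem f * ρ.endo (elem g) := rfl

@[simp] theorem elem_whiskerLeft (ρ : Tt N) {σ σ' : Tt N} (g : σ ⟶ σ') :
    elem (ρ ◁ g) = ρ.endo (elem g) := rfl

@[simp] theorem elem_whiskerRight {ρ ρ' : Tt N} (f : ρ ⟶ ρ') (σ : Tt N) :
    elem (f ▷ σ) = elem f := rfl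

@[simp] theorem elem_associator_hom (ρ σ τ : Tt N) : elem (α_ ρ σ τ).hom = 1 := rfl

@[simp] theorem elem_leftUnitor_hom (ρ : Tt N) : elem (λ_ ρ).hom = 1 := rfl

@[simp] theorem elem_rightUnitor_hom (ρ : Tt N) : elem (ρ_ ρ).hom = 1 := rfl

instance : MonoidalCategory (Tt N) :=
  MonoidalCategory.ofTensorHom
    (id_tensorHom_id := fun ρ σ => hom_ext (by simp))
    (id_tensorHom := fun ρ _ _ f => hom_ext (by simp))
    (tensorHom_id := fun f σ => hom_ext (by simp))
    (tensorHom_comp_tensorHom := fun {ρ₁ σ₁ _ _ _ _} f₁ f₂ g₁ g₂ => hom_ext (by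
      simp only [elem_comp, elem_tensorHom, map_mul]
      rw [mul_assoc, ← mul_assoc (σ₁.endo _), ← elem_intertwines]
      simp only [mul_assoc]))
    (associator_naturality := fun f₁ f₂ f₃ => hom_ext (by simp [mul_assoc]))
    (leftUnitor_naturality := fun f => hom_ext (by simp))
    (rightUnitor_naturality := fun f => hom_ext (by simp))
    (pentagon := fun _ _ _ _ => hom_ext (by simp))
    (triangle := fun _ _ => hom_ext (by simp))

/-- `ε` is the canonical permutation symmetry of `𝒯_t(𝔄)`: if `U₁ ∈ (ρ, ρ₁)` and
`U₂ ∈ (σ, σ₂)` are unitaries, where `ρ₁` and `σ₂` are localized in spacelike separated double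
cones, then `ε(ρ, σ) = (U₂ ⊗ U₁)* (U₁ ⊗ U₂)`. -/
def IsCanonicalSymmetry (N : Net s 𝔄) (ε : SymmetricCategory (Tt N)) : Prop :=
  ∀ (ρ σ ρ₁ σ₂ : Tt N) (O₁ O₂ : DoubleCone s), O₁.SpacelikeTo O₂ →
    N.LocalizedIn ρ₁.endo O₁ → N.LocalizedIn σ₂.endo O₂ →
    ∀ (U₁ : ρ ⟶ ρ₁) (U₂ : σ ⟶ σ₂), elem U₁ ∈ unitary 𝔄 → elem U₂ ∈ unitary 𝔄 →
      elem (ε.braiding ρ σ).hom = star (elem (U₂ ⊗ₘ U₁)) * elem (U₁ ⊗ₘ U₂)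

end Tt

/-! ### One-cocycles and the endomorphisms they define -/

/-- A `1`-cocycle of the net: `z(∂₀c) z(∂₂c) = z(∂₁c)`, with `z(b)` a unitary of `𝔄(|b|)`. -/
structure OneCocycle (N : Net s 𝔄) where
  toFun : OneSimplex s → 𝔄
  unitary_mem : ∀ b, toFun b ∈ unitary 𝔄
  local_mem : ∀ b, toFun b ∈ N.alg b.support
  cocycle : ∀ c : TwoSimplex s, toFun c.face0 * toFun c.face2 = toFun c.face1

/-- `ρ` is the endomorphism `ρ_a` which the cocycle `z` defines at the double cone `a`:
`ρ(A) = z(b) A z(b)*` whenever `A ∈ 𝔄(O)`, `∂₀b = a` and `∂₁b ⊆ O'`. -/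
def OneCocycle.Induces {N : Net s 𝔄} (z : N.OneCocycle) (a : DoubleCone s) (ρ : 𝔄 →⋆ₐ[ℂ] 𝔄) :
    Prop :=
  ∀ O : DoubleCone s, ∀ A ∈ N.alg O, ∀ b : OneSimplex s, b.face0 = a → b.face1.SpacelikeTo O →
    ρ A = z.toFun b * A * star (z.toFun b)

/-- The image of a `1`-cocycle of `𝔄` under an inclusion of nets `𝔄 ⊆ 𝔅`. -/
def OneCocycle.map {A : Net s 𝔄} {B : Net s 𝔅} (i : A.Inclusion B) (z : A.OneCocycle) :
    B.OneCocycle where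
  toFun b := i.hom (z.toFun b)
  unitary_mem b := Unitary.map_mem i.hom (z.unitary_mem b)
  local_mem b := i.map_mem _ _ (z.local_mem b)
  cocycle c := by rw [← map_mul, z.cocycle]

end Net

end

/-!
By the cocycle identity `z(b)` depends only on the faces of `b`, so a cocycle is a family of
unitaries `z(a, b)` with `z(a, b) z(b, c) = z(a, c)`. To define `ρ_a(A) = z(a, b) A z(a, b)*` for
`A ∈ 𝔄(O)` and `b ⊆ O'` one needs independence of `b`, i.e. that `z(b, c)` commutes with `𝔄(O)`
whenever `b, c ⊆ O'`. This is clear if `b ⊆ c`, and the general case follows by joining `b` to `c`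
by a chain of overlapping double cones in `O'`: in spacetime dimension at least three the interior
of `O'` is connected. By density `ρ_a` extends to `𝔄`, as the limit of `z(a, b) · z(a, b)*` for `b`
tending to spacelike infinity. Conversely, a field of unitaries transporting `ρ` is a trivialisation
of a cocycle.

The same chain argument shows that transportable endomorphisms act trivially on intertwiners between
endomorphisms localized in double cones spacelike to them. This makes `(U₂ ⊗ U₁)* (U₁ ⊗ U₂)`
independent of the unitaries `U₁`, `U₂`.

A cocycle of `𝔄` is also one of `𝔅`, so an object `ρ` of `𝒯_t(𝔄)` extends to `𝔅`. The extension is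
characterised, independently of cocycles, by `ψ(X) = U* X U` for `X ∈ 𝔅(O)` and `U` a unitary
transporting `ρ` into `O'`; functoriality and the preservation of the tensor product and of the
symmetry all follow from this formula and uniqueness.
-/

noncomputable section

open Minkowski
open scoped CStarAlgebra

/-! ### Connectedness of the spacelike complement of a double cone -/

section Connectedness

variable {E : Type*} [NormedAddCommGroup E] [NormedSpace ℝ E]

theorem lineMap_notMem_of_convex {K : Set E} (hK : Convex ℝ K) {c x : E} (hc : c ∈ K)
    (hx : x ∉ K) {t : ℝ} (ht : 1 ≤ t) : AffineMap.lineMap c x t ∉ K := by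
  refine fun hmem => hx ?_
  have hback : AffineMap.lineMap c (AffineMap.lineMap c x t) t⁻¹ = x := by
    rw [AffineMap.lineMap_lineMap_right, inv_mul_cancel₀ (by positivity),
      AffineMap.lineMap_apply_one]
  exact hback ▸ hK.lineMap_mem hc hmem ⟨by positivity, inv_le_one_of_one_le₀ ht⟩

theorem isPreconnected_compl_of_convex_of_isBounded (hE : 1 < Module.rank ℝ E) {K : Set E}
    (hK : Convex ℝ K) (hb : Bornology.IsBounded K) : IsPreconnected Kᶜ := by
  obtain rfl | ⟨c, hc⟩ := K.eq_empty_or_nonempty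
  · simpa using isPreconnected_univ
  refine isPreconnected_of_forall_pair fun x hx y hy => ?_
  obtain ⟨r, hr, hball⟩ := ((hb.insert y).insert x).subset_ball_lt 0 c
  have hsphere : Metric.sphere c r ⊆ Kᶜ := fun v hv hvK =>
    Metric.sphere_disjoint_ball.notMem_of_mem_left hv (hball (by simp [hvK]))
  let ray (z : E) : Set E := AffineMap.lineMap c z '' Set.Ici (1 : ℝ)
  have hray (z : E) : IsPreconnected (ray z) :=
    isPreconnected_Ici.image _ AffineMap.lineMap_continuous.continuousOn
  have mem_ray (z : E) : z ∈ ray z := ⟨1, by simp, by simp⟩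
  have ray_subset {z : E} (hz : z ∉ K) : ray z ⊆ Kᶜ := by
    rintro _ ⟨t, ht, rfl⟩
    exact lineMap_notMem_of_convex hK hc hz ht
  have ray_inter {z : E} (hz : z ∉ K) (hzr : z ∈ Metric.ball c r) :
      (ray z ∩ Metric.sphere c r).Nonempty := by
    have hzc : 0 < dist c z := dist_pos.2 fun h => hz (h ▸ hc)
    rw [Metric.mem_ball'] at hzr
    refine ⟨_, ⟨r / dist c z, (one_le_div hzc).2 hzr.le, rfl⟩, ?_⟩
    rw [Metric.mem_sphere, dist_lineMap_left, Real.norm_of_nonneg (by positivity),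
      div_mul_cancel₀ _ hzc.ne']
  obtain ⟨p, hp, hp'⟩ := ray_inter hx (hball (by simp))
  obtain ⟨q, hq, hq'⟩ := ray_inter hy (hball (by simp))
  refine ⟨ray x ∪ Metric.sphere c r ∪ ray y,
    Set.union_subset (Set.union_subset (ray_subset hx) hsphere) (ray_subset hy),
    .inl (.inl (mem_ray x)), .inr (mem_ray y), ?_⟩
  exact ((hray x).union p hp hp' (isPreconnected_sphere hE c r)).union q (.inr hq') hq (hray y)

theorem isPreconnected_setOf_lt_norm_sub_add_norm_sub (hE : 1 < Module.rank ℝ E) (p q : E) (r : ℝ) :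
    IsPreconnected {v : E | r < ‖v - p‖ + ‖v - q‖} := by
  have hconv : Convex ℝ {v : E | ‖v - p‖ + ‖v - q‖ ≤ r} := by
    simpa [dist_eq_norm] using ((convexOn_univ_dist p).add (convexOn_univ_dist q)).convex_le r
  have hb : Bornology.IsBounded {v : E | ‖v - p‖ + ‖v - q‖ ≤ r} :=
    Metric.isBounded_closedBall.subset fun v (hv : ‖v - p‖ + ‖v - q‖ ≤ r) =>
      mem_closedBall_iff_norm.2 (le_of_add_le_of_nonneg_left hv (norm_nonneg _))
  simpa [Set.compl_ofPred] using isPreconnected_compl_of_convex_of_isBounded hE hconv hb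

theorem isPreconnected_between_graphs {X : Type*} [TopologicalSpace X] {S : Set X}
    (hS : IsPreconnected S) {l u : X → ℝ} (hl : Continuous l) (hu : Continuous u)
    (hlu : ∀ x ∈ S, l x < u x) :
    IsPreconnected {p : ℝ × X | p.2 ∈ S ∧ l p.2 < p.1 ∧ p.1 < u p.2} := by
  let f : ℝ × X → ℝ × X := fun p => (AffineMap.lineMap (l p.2) (u p.2) p.1, p.2)
  have hf : Continuous f := by
    simp only [f, AffineMap.lineMap_apply_ring']
    fun_prop
  have himage {x : X} (hx : x ∈ S) :
      AffineMap.lineMap (l x) (u x) '' Set.Ioo (0 : ℝ) 1 = Set.Ioo (l x) (u x) := by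
    rw [← openSegment_eq_image_lineMap, openSegment_eq_Ioo (hlu x hx)]
  convert ((isPreconnected_Ioo (a := (0 : ℝ)) (b := 1)).prod hS).image f hf.continuousOn using 1
  ext ⟨t, x⟩
  constructor
  · rintro ⟨hx, ht⟩
    obtain ⟨θ, hθ, hθt⟩ := (himage hx).symm.subset ht
    exact ⟨(θ, x), ⟨hθ, hx⟩, Prod.ext hθt rfl⟩
  · rintro ⟨⟨θ, y⟩, ⟨hθ, hy⟩, h⟩
    obtain ⟨rfl, rfl⟩ := Prod.mk.inj h
    exact ⟨hy, (himage hy).subset ⟨θ, hθ, rfl⟩⟩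

end Connectedness

namespace Minkowski

variable {s : ℕ}

theorem Spacelike.symm {x y : Minkowski s} (h : Spacelike x y) : Spacelike y x := by
  unfold Spacelike at *
  rwa [abs_sub_comm, norm_sub_rev]

theorem isOpen_setOf_inForwardCone : IsOpen {x : Minkowski s | InForwardCone x} :=
  isOpen_lt (by fun_prop) (by fun_prop)

theorem InForwardCone.smul {x : Minkowski s} (hx : InForwardCone x) {t : ℝ} (ht : 0 < t) :
    InForwardCone (t • x) := by
  simpa only [InForwardCone, Prod.smul_snd, Prod.smul_fst, norm_smul, Real.norm_of_nonneg ht.le,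
    smul_eq_mul] using mul_lt_mul_of_pos_left hx ht

theorem abs_sub_le_norm_sub_of_mem_closure {S : Set (Minkowski s)} {x y : Minkowski s}
    (hx : x ∈ causalComplement S) (hy : y ∈ closure S) : |x.1 - y.1| ≤ ‖x.2 - y.2‖ :=
  have hclosed : IsClosed {y : Minkowski s | |x.1 - y.1| ≤ ‖x.2 - y.2‖} :=
    isClosed_le (by fun_prop) (by fun_prop)
  closure_minimal (fun z hz => (hx z hz).le) hclosed hy

end Minkowski

namespace DoubleCone

variable {s : ℕ}

theorem isOpen_region (O : DoubleCone s) : IsOpen O.region :=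
  (isOpen_setOf_inForwardCone.preimage (continuous_sub_right O.past)).inter
    (isOpen_setOf_inForwardCone.preimage (continuous_sub_left O.future))

theorem openSegment_subset_region (O : DoubleCone s) :
    openSegment ℝ O.past O.future ⊆ O.region := by
  rw [openSegment_eq_image']
  rintro _ ⟨t, ⟨ht₀, ht₁⟩, rfl⟩
  refine ⟨by simpa using O.timelike.smul ht₀, ?_⟩
  have hsub : O.future - (O.past + t • (O.future - O.past)) = (1 - t) • (O.future - O.past) := by
    module
  exact hsub ▸ O.timelike.smul (sub_pos.2 ht₁)

theorem region_nonempty (O : DoubleCone s) : O.region.Nonempty :=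
  ⟨_, O.openSegment_subset_region (midpoint_mem_openSegment _ _)⟩

theorem segment_subset_closure_region (O : DoubleCone s) :
    segment ℝ O.past O.future ⊆ closure O.region :=
  segment_subset_closure_openSegment.trans (closure_mono O.openSegment_subset_region)

theorem SpacelikeTo.symm {O₁ O₂ : DoubleCone s} (h : O₁.SpacelikeTo O₂) : O₂.SpacelikeTo O₁ :=
  fun _ hx _ hy => (h hy _ hx).symm

theorem SpacelikeTo.mono_left {O O₁ O₂ : DoubleCone s} (h : O₁.SpacelikeTo O₂) (h' : O.Sub O₁) :
    O.SpacelikeTo O₂ := Set.Subset.trans h' h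

theorem mem_causalComplement_region_iff {O : DoubleCone s} {x : Minkowski s} :
    x ∈ causalComplement O.region ↔
      x.1 - O.past.1 ≤ ‖x.2 - O.past.2‖ ∧ O.future.1 - x.1 ≤ ‖x.2 - O.future.2‖ := by
  constructor
  · intro hx
    have hpast := abs_sub_le_norm_sub_of_mem_closure hx
      (O.segment_subset_closure_region (left_mem_segment ..))
    have hfuture := abs_sub_le_norm_sub_of_mem_closure hx
      (O.segment_subset_closure_region (right_mem_segment ..))
    exact ⟨(le_abs_self _).trans hpast, by linarith [neg_le_abs (x.1 - O.future.1)]⟩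
  · rintro ⟨hpast, hfuture⟩ y ⟨hy₁, hy₂⟩
    simp only [InForwardCone, Prod.fst_sub, Prod.snd_sub] at hy₁ hy₂
    rw [norm_sub_rev] at hy₂
    have h₁ := norm_sub_le_norm_sub_add_norm_sub x.2 y.2 O.past.2
    have h₂ := norm_sub_le_norm_sub_add_norm_sub x.2 y.2 O.future.2
    exact abs_lt.2 ⟨by linarith, by linarith⟩

theorem mem_interior_causalComplement_region_iff {O : DoubleCone s} {x : Minkowski s} :
    x ∈ interior (causalComplement O.region) ↔
      x.1 - O.past.1 < ‖x.2 - O.past.2‖ ∧ O.future.1 - x.1 < ‖x.2 - O.future.2‖ := by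
  constructor
  · intro hx
    have hshift : Continuous fun t : ℝ => (x.1 + t, x.2) := by fun_prop
    have hnear : ∀ᶠ t in nhds (0 : ℝ), (x.1 + t, x.2) ∈ causalComplement O.region :=
      hshift.continuousAt.eventually (by simpa using mem_interior_iff_mem_nhds.1 hx)
    obtain ⟨t, ht₀, ht⟩ := ((eventually_mem_nhdsWithin (s := Set.Ioi 0)).and
      (hnear.filter_mono nhdsWithin_le_nhds)).exists
    obtain ⟨t', ht₀', ht'⟩ := ((eventually_mem_nhdsWithin (s := Set.Iio 0)).and
      (hnear.filter_mono nhdsWithin_le_nhds)).exists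
    rw [Set.mem_Ioi] at ht₀
    rw [Set.mem_Iio] at ht₀'
    exact ⟨by linarith [(mem_causalComplement_region_iff.1 ht).1],
      by linarith [(mem_causalComplement_region_iff.1 ht').2]⟩
  · intro hx
    have hopen : IsOpen {x : Minkowski s |
        x.1 - O.past.1 < ‖x.2 - O.past.2‖ ∧ O.future.1 - x.1 < ‖x.2 - O.future.2‖} :=
      (isOpen_lt (by fun_prop) (by fun_prop)).and (isOpen_lt (by fun_prop) (by fun_prop))
    exact interior_maximal (fun y hy => mem_causalComplement_region_iff.2 ⟨hy.1.le, hy.2.le⟩)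
      hopen hx

theorem SpacelikeTo.subset_interior {O₁ O₂ : DoubleCone s} (h : O₁.SpacelikeTo O₂) :
    O₁.region ⊆ interior (causalComplement O₂.region) :=
  interior_maximal h O₁.isOpen_region

-- Over each position outside the ellipsoid with foci at the positions of the two vertices, the
-- admissible times form a nonempty interval.
theorem isPreconnected_interior_causalComplement (hs : 2 ≤ s) (O : DoubleCone s) :
    IsPreconnected (interior (causalComplement O.region)) := by
  have hrank : 1 < Module.rank ℝ (EuclideanSpace ℝ (Fin s)) := by
    rw [← Module.finrank_eq_rank, finrank_euclideanSpace_fin]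
    exact_mod_cast hs
  have hpre := isPreconnected_between_graphs
    (isPreconnected_setOf_lt_norm_sub_add_norm_sub hrank O.past.2 O.future.2
      (O.future.1 - O.past.1))
    (l := fun v => O.future.1 - ‖v - O.future.2‖) (u := fun v => O.past.1 + ‖v - O.past.2‖)
    (by fun_prop) (by fun_prop) fun v hv => by linarith [Set.mem_ofPred.1 hv]
  convert hpre using 1
  ext x
  rw [mem_interior_causalComplement_region_iff]
  constructor
  · rintro ⟨hpast, hfuture⟩
    exact ⟨Set.mem_ofPred.2 (by linarith), by linarith, by linarith⟩
  · rintro ⟨-, hl, hu⟩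
    exact ⟨by linarith, by linarith⟩

theorem exists_mem_region_subset {W : Set (Minkowski s)} {x : Minkowski s} (hW : W ∈ nhds x) :
    ∃ d : DoubleCone s, x ∈ d.region ∧ d.region ⊆ W := by
  obtain ⟨δ, hδ, hball⟩ := Metric.mem_nhds_iff.1 hW
  refine ⟨⟨(x.1 - δ, x.2), (x.1 + δ, x.2), ?_⟩, ⟨?_, ?_⟩, fun y hy => hball ?_⟩
  · simpa [InForwardCone] using by linarith
  · simpa [InForwardCone] using hδ
  · simpa [InForwardCone] using hδ
  · obtain ⟨hy₁, hy₂⟩ := hy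
    simp only [InForwardCone, Prod.fst_sub, Prod.snd_sub] at hy₁ hy₂
    rw [norm_sub_rev] at hy₂
    have hnorm := norm_nonneg (y.2 - x.2)
    rw [Metric.mem_ball, Prod.dist_eq, max_lt_iff, Real.dist_eq, dist_eq_norm, abs_lt]
    exact ⟨⟨by linarith, by linarith⟩, by linarith⟩

theorem exists_sub_inter {O₁ O₂ : DoubleCone s} {x : Minkowski s} (h₁ : x ∈ O₁.region)
    (h₂ : x ∈ O₂.region) : ∃ O : DoubleCone s, O.Sub O₁ ∧ O.Sub O₂ :=
  let ⟨O, _, hO⟩ := exists_mem_region_subset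
    (Filter.inter_mem (O₁.isOpen_region.mem_nhds h₁) (O₂.isOpen_region.mem_nhds h₂))
  ⟨O, hO.trans Set.inter_subset_left, hO.trans Set.inter_subset_right⟩

-- The interior of `c'` is connected, so any two double cones in it are joined by a chain of
-- successively overlapping ones.
theorem SpacelikeTo.chain_induction (hs : 2 ≤ s) {c : DoubleCone s}
    {R : DoubleCone s → DoubleCone s → Prop}
    (htrans : ∀ {d e f}, d.SpacelikeTo c → e.SpacelikeTo c → f.SpacelikeTo c →
      R d e → R e f → R d f)
    (hsub : ∀ {d e}, d.Sub e → e.SpacelikeTo c → R d e ∧ R e d)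
    {d e : DoubleCone s} (hd : d.SpacelikeTo c) (he : e.SpacelikeTo c) : R d e := by
  have of_common_point {d e : DoubleCone s} {x : Minkowski s} (hd : d.SpacelikeTo c)
      (he : e.SpacelikeTo c) (hxd : x ∈ d.region) (hxe : x ∈ e.region) : R d e := by
    obtain ⟨m, hmd, hme⟩ := exists_sub_inter hxd hxe
    exact htrans hd (hd.mono_left hmd) he (hsub hmd hd).2 (hsub hme he).1
  have exists_mem {x : Minkowski s} (hx : x ∈ interior (causalComplement c.region)) :
      ∃ b : DoubleCone s, x ∈ b.region ∧ b.SpacelikeTo c :=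
    exists_mem_region_subset (mem_interior_iff_mem_nhds.1 hx)
  let P (x y : Minkowski s) : Prop := ∀ d e : DoubleCone s, d.SpacelikeTo c → e.SpacelikeTo c →
    x ∈ d.region → y ∈ e.region → R d e
  obtain ⟨x, hx⟩ := d.region_nonempty
  obtain ⟨y, hy⟩ := e.region_nonempty
  refine (isPreconnected_interior_causalComplement hs c).induction₂' P (fun x hx => ?_)
    (fun x y z _ hy _ hxy hyz d f hd hf hxd hzf => ?_)
    (hd.subset_interior hx) (he.subset_interior hy) d e hd he hx hy
  · obtain ⟨b, hxb, hbc⟩ := exists_mem hx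
    filter_upwards [nhdsWithin_le_nhds (b.isOpen_region.mem_nhds hxb)] with y hyb
    exact ⟨fun d e hd he hxd hye => htrans hd hbc he (of_common_point hd hbc hxd hxb)
        (of_common_point hbc he hyb hye),
      fun d e hd he hyd hxe => htrans hd hbc he (of_common_point hd hbc hyd hyb)
        (of_common_point hbc he hxb hxe)⟩
  · obtain ⟨e, hye, hec⟩ := exists_mem hy
    exact htrans hd hec hf (hxy d e hd hec hxd hye) (hyz e f hec hf hye hzf)

theorem exists_spacelikeTo (hs : 0 < s) (O : DoubleCone s) :
    ∃ b : DoubleCone s, b.SpacelikeTo O := by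
  have : Nontrivial (EuclideanSpace ℝ (Fin s)) :=
    Module.nontrivial_of_finrank_pos (R := ℝ) (by simpa using hs)
  let r := 2 + |O.past.1| + |O.future.1| + ‖O.past.2‖ + ‖O.future.2‖
  obtain ⟨w, hw⟩ := exists_norm_eq (EuclideanSpace ℝ (Fin s)) (show 0 ≤ r by positivity)
  refine ⟨⟨(0, w), (1, w), by simp [InForwardCone]⟩, fun x ⟨hx₁, hx₂⟩ => ?_⟩
  simp only [InForwardCone, Prod.fst_sub, Prod.snd_sub, sub_zero, norm_sub_rev w] at hx₁ hx₂
  have hxw : r < 1 + ‖x.2‖ := by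
    linarith [norm_sub_norm_le w x.2, norm_sub_rev w x.2]
  have hpast := norm_sub_norm_le x.2 O.past.2
  have hfuture := norm_sub_norm_le x.2 O.future.2
  have := norm_nonneg (x.2 - w)
  rw [mem_causalComplement_region_iff]
  constructor <;>
    linarith [neg_abs_le O.past.1, le_abs_self O.future.1, abs_nonneg O.past.1,
      abs_nonneg O.future.1, norm_nonneg O.past.2, norm_nonneg O.future.2]

variable (s) in
/-- The filter of spacelike infinity: a property holds eventually if, for some double cone `O`, it
holds for all double cones contained in `O'`. -/
def spacelikeInfinity : Filter (DoubleCone s) := ⨅ O, Filter.principal {b | b.SpacelikeTo O}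

theorem eventually_spacelikeTo (O : DoubleCone s) : ∀ᶠ b in spacelikeInfinity s, b.SpacelikeTo O :=
  Filter.mem_iInf_of_mem O (Filter.mem_principal_self _)

theorem neBot_spacelikeInfinity (hs : 0 < s) : (spacelikeInfinity s).NeBot := by
  have : Nonempty (DoubleCone s) := ⟨⟨0, (1, 0), by simp [InForwardCone]⟩⟩
  refine Filter.iInf_neBot_of_directed' (fun O₁ O₂ => ?_) fun O =>
    Filter.principal_neBot_iff.2 (exists_spacelikeTo hs O)
  obtain ⟨O, h₁, h₂⟩ := exists_sup O₁ O₂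
  exact ⟨O, Filter.principal_mono.2 fun _ hb => hb.mono h₁,
    Filter.principal_mono.2 fun _ hb => hb.mono h₂⟩

end DoubleCone

/-! ### Limits of *-homomorphisms and unitary conjugation -/

section Limits

open Filter Topology

theorem exists_tendsto_of_equicontinuous_of_dense {ι X α : Type*} [TopologicalSpace X]
    [PseudoMetricSpace α] [CompleteSpace α] {F : ι → X → α} {l : Filter ι} [l.NeBot]
    (hF : Equicontinuous F) {D : Set X} (hD : Dense D)
    (hlim : ∀ d ∈ D, ∃ y, Tendsto (F · d) l (𝓝 y)) (x : X) : ∃ y, Tendsto (F · x) l (𝓝 y) := by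
  refine cauchy_map_iff_exists_tendsto.1 (Metric.cauchy_iff.2 ⟨inferInstance, fun ε hε => ?_⟩)
  obtain ⟨d, hdD, hdx⟩ :=
    hD.inter_nhds_nonempty (Metric.equicontinuousAt_iff_right.1 (hF x) (ε / 4) (by positivity))
  obtain ⟨y, hy⟩ := hlim d hdD
  have near : ∀ᶠ n in l, dist (F n x) y < ε / 2 := by
    filter_upwards [Metric.tendsto_nhds.1 hy (ε / 4) (by positivity)] with n hn
    calc dist (F n x) y ≤ dist (F n x) (F n d) + dist (F n d) y := dist_triangle _ _ _
      _ < ε / 2 := by linarith [hdx n]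
  refine ⟨Metric.ball y (ε / 2), near, fun u hu w hw => ?_⟩
  calc dist u w ≤ dist u y + dist w y := dist_triangle_right _ _ _
    _ < ε := by linarith [Metric.mem_ball.1 hu, Metric.mem_ball.1 hw]

variable {𝔄 : Type u} [CStarAlgebra 𝔄] {𝔅 : Type v} [CStarAlgebra 𝔅]

theorem equicontinuous_starAlgHom {ι : Type*} (φ : ι → 𝔄 →⋆ₐ[ℂ] 𝔅) :
    Equicontinuous fun n => (φ n : 𝔄 → 𝔅) :=
  (LipschitzWith.uniformEquicontinuous _ 1 fun n => LipschitzWith.of_dist_le_mul fun x y => by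
    rw [NNReal.coe_one, one_mul, dist_eq_norm, dist_eq_norm, ← map_sub]
    exact NonUnitalStarAlgHom.norm_apply_le (φ n) (x - y)).equicontinuous

theorem exists_starAlgHom_tendsto_of_dense {ι : Type*} {l : Filter ι} [l.NeBot]
    {φ : ι → 𝔄 →⋆ₐ[ℂ] 𝔅} {D : Set 𝔄} (hD : Dense D)
    (hlim : ∀ d ∈ D, ∃ y, Tendsto (φ · d) l (𝓝 y)) :
    ∃ ψ : 𝔄 →⋆ₐ[ℂ] 𝔅, ∀ x, Tendsto (φ · x) l (𝓝 (ψ x)) := by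
  choose f hf using
    exists_tendsto_of_equicontinuous_of_dense (equicontinuous_starAlgHom φ) hD hlim
  refine ⟨{ toFun := f
            map_one' := tendsto_nhds_unique (hf 1) (by simp)
            map_mul' := fun x y =>
              tendsto_nhds_unique (hf (x * y)) (by simpa using (hf x).mul (hf y))
            map_zero' := tendsto_nhds_unique (hf 0) (by simp)
            map_add' := fun x y =>
              tendsto_nhds_unique (hf (x + y)) (by simpa using (hf x).add (hf y))
            commutes' := fun r => tendsto_nhds_unique (hf (algebraMap ℂ 𝔄 r)) (by
              simpa only [AlgHomClass.commutes] using tendsto_const_nhds)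
            map_star' := fun x =>
              tendsto_nhds_unique (hf (star x)) (by simpa [map_star] using (hf x).star) }, hf⟩

end Limits

section Unitaries

variable {R : Type*} [Monoid R] [StarMul R]

theorem semiconjBy_star_of_mem_unitary {U x y : R} (hU : U ∈ unitary R) (h : SemiconjBy U x y) :
    SemiconjBy (star U) y x :=
  SemiconjBy.units_inv_symm_left (a := Unitary.toUnits ⟨U, hU⟩) h

theorem semiconjBy_iff_mul_mul_star_eq {U x y : R} (hU : U ∈ unitary R) :
    SemiconjBy U x y ↔ U * x * star U = y :=
  (Units.mul_inv_eq_iff_eq_mul (Unitary.toUnits ⟨U, hU⟩)).symm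

theorem eq_of_semiconjBy_of_mem_unitary {U x x' y : R} (hU : U ∈ unitary R) (h : SemiconjBy U x y)
    (h' : SemiconjBy U x' y) : x = x' :=
  (Unitary.isUnit_coe (U := ⟨U, hU⟩)).mul_left_cancel (h.eq.trans h'.eq.symm)

end Unitaries

/-! ### Endomorphisms and one-cocycles -/

section Intertwiners

variable {𝔄 : Type u} [CStarAlgebra 𝔄] {𝔅 : Type v} [CStarAlgebra 𝔅]

/-- `T ρ(A) = σ(A) T` for all `A`, i.e. `T ∈ (ρ, σ)`. -/
def Intertwines (T : 𝔅) (ρ σ : 𝔄 →⋆ₐ[ℂ] 𝔅) : Prop := ∀ x, SemiconjBy T (ρ x) (σ x)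

namespace Intertwines

variable {S T : 𝔅} {ρ σ τ : 𝔄 →⋆ₐ[ℂ] 𝔅}

theorem one (ρ : 𝔄 →⋆ₐ[ℂ] 𝔅) : Intertwines 1 ρ ρ := fun x => SemiconjBy.one_left (ρ x)

theorem mul (hS : Intertwines S σ τ) (hT : Intertwines T ρ σ) : Intertwines (S * T) ρ τ :=
  fun x => (hS x).mul_left (hT x)

theorem star (hT : Intertwines T ρ σ) (hu : T ∈ unitary 𝔅) : Intertwines (star T) σ ρ :=
  fun x => semiconjBy_star_of_mem_unitary hu (hT x)

theorem conj (u : unitary 𝔅) (ρ : 𝔄 →⋆ₐ[ℂ] 𝔅) :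
    Intertwines (u : 𝔅) ρ ((Unitary.conjStarAlgAut ℂ 𝔅 u).toStarAlgHom.comp ρ) :=
  fun _ => (semiconjBy_iff_mul_mul_star_eq u.2).2 rfl

theorem comp {R : 𝔄} {φ χ : 𝔄 →⋆ₐ[ℂ] 𝔄} (hS : Intertwines S ρ σ) (hR : Intertwines R φ χ) :
    Intertwines (S * ρ R) (ρ.comp φ) (σ.comp χ) :=
  fun x => (hS (χ x)).mul_left ((hR x).map ρ)

end Intertwines

end Intertwiners

namespace Net

variable {s : ℕ} {𝔄 : Type u} [CStarAlgebra 𝔄] {𝔅 : Type v} [CStarAlgebra 𝔅] {N : Net s 𝔄}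

theorem continuous_ext (N : Net s 𝔄) {Y : Type*} [TopologicalSpace Y] [T2Space Y] {f g : 𝔄 → Y}
    (hf : Continuous f) (hg : Continuous g) (h : ∀ O, ∀ x ∈ N.alg O, f x = g x) : f = g := by
  refine Continuous.ext_on N.dense hf hg fun x hx => ?_
  obtain ⟨O, hO⟩ := Set.mem_iUnion.1 hx
  exact h O x hO

theorem starAlgHom_ext (N : Net s 𝔄) {φ ψ : 𝔄 →⋆ₐ[ℂ] 𝔅} (h : ∀ O, ∀ x ∈ N.alg O, φ x = ψ x) :
    φ = ψ :=
  DFunLike.coe_injective (N.continuous_ext (map_continuous φ) (map_continuous ψ) h)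

namespace RelativeDuality

theorem mem_iff (hN : N.RelativeDuality) {O : DoubleCone s} {x : 𝔄} :
    x ∈ N.alg O ↔ ∀ O₁ : DoubleCone s, O₁.SpacelikeTo O → ∀ y ∈ N.alg O₁, Commute x y :=
  Set.ext_iff.1 (hN O) x

theorem commute (hN : N.RelativeDuality) {O O₁ : DoubleCone s} (h : O₁.SpacelikeTo O) {x y : 𝔄}
    (hx : x ∈ N.alg O) (hy : y ∈ N.alg O₁) : Commute x y :=
  hN.mem_iff.1 hx O₁ h y hy

theorem intertwiner_mem (hN : N.RelativeDuality) {O : DoubleCone s} {ρ σ : 𝔄 →⋆ₐ[ℂ] 𝔄}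
    (hρ : N.LocalizedIn ρ O) (hσ : N.LocalizedIn σ O) {T : 𝔄} (hT : Intertwines T ρ σ) :
    T ∈ N.alg O :=
  hN.mem_iff.2 fun O₁ hO₁ y hy => by
    simpa only [Commute, hρ O₁ hO₁ y hy, hσ O₁ hO₁ y hy] using hT y

theorem localizedIn_map_mem (hN : N.RelativeDuality) {c O : DoubleCone s} {ρ : 𝔄 →⋆ₐ[ℂ] 𝔄}
    (hρ : N.LocalizedIn ρ c) (hc : c.Sub O) {x : 𝔄} (hx : x ∈ N.alg O) : ρ x ∈ N.alg O :=
  hN.mem_iff.2 fun O₁ hO₁ y hy => by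
    simpa only [hρ O₁ (hO₁.mono hc) y hy] using (hN.commute hO₁ hx hy).map ρ

end RelativeDuality

namespace OneCocycle

variable (z : N.OneCocycle)

/-- The value of a cocycle on a `1`-simplex with faces `a` and `b`. By the cocycle identity it does
not depend on the support, so that a cocycle is a trivialised groupoid of unitaries on pairs of
double cones. -/
def arrow (a b : DoubleCone s) : unitary 𝔄 :=
  let h := DoubleCone.exists_sup a b
  ⟨z.toFun ⟨h.choose, a, b, h.choose_spec.1, h.choose_spec.2⟩, z.unitary_mem _⟩

theorem toFun_mul {a b c O₀ O₁ O₂ : DoubleCone s} (h₀a : a.Sub O₀) (h₀b : b.Sub O₀)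
    (h₁a : a.Sub O₁) (h₁c : c.Sub O₁) (h₂b : b.Sub O₂) (h₂c : c.Sub O₂) :
    z.toFun ⟨O₀, a, b, h₀a, h₀b⟩ * z.toFun ⟨O₂, b, c, h₂b, h₂c⟩ =
      z.toFun ⟨O₁, a, c, h₁a, h₁c⟩ := by
  obtain ⟨P, hP₀, hP₁⟩ := DoubleCone.exists_sup O₀ O₁
  obtain ⟨Q, hQP, hQ₂⟩ := DoubleCone.exists_sup P O₂
  exact z.cocycle ⟨Q, O₀, O₁, O₂, a, b, c, hP₀.trans hQP, hP₁.trans hQP, hQ₂, h₀a, h₀b, h₁a, h₁c,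
    h₂b, h₂c⟩

theorem arrow_mul (a b c : DoubleCone s) : z.arrow a b * z.arrow b c = z.arrow a c :=
  Subtype.ext (z.toFun_mul _ _ _ _ _ _)

@[simp] theorem arrow_self (a : DoubleCone s) : z.arrow a a = 1 :=
  mul_eq_left.1 (z.arrow_mul a a a)

theorem star_arrow (a b : DoubleCone s) : star (z.arrow a b) = z.arrow b a := by
  rw [Unitary.star_eq_inv, inv_eq_iff_mul_eq_one, arrow_mul, arrow_self]

theorem semiconjBy_arrow_symm {a b : DoubleCone s} {x y : 𝔄}
    (h : SemiconjBy (z.arrow a b : 𝔄) x y) : SemiconjBy (z.arrow b a : 𝔄) y x := by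
  rw [← z.star_arrow]
  exact semiconjBy_star_of_mem_unitary (z.arrow a b).2 h

theorem toFun_eq_arrow (b : OneSimplex s) : z.toFun b = z.arrow b.face0 b.face1 := by
  have h : z.toFun b * z.arrow b.face1 b.face1 = z.arrow b.face0 b.face1 :=
    z.toFun_mul b.sub0 b.sub1 _ _ _ _
  rwa [arrow_self, OneMemClass.coe_one, mul_one] at h

theorem arrow_mem_alg {a b O : DoubleCone s} (ha : a.Sub O) (hb : b.Sub O) :
    (z.arrow a b : 𝔄) ∈ N.alg O := by
  rw [← z.toFun_eq_arrow ⟨O, a, b, ha, hb⟩]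
  exact z.local_mem ⟨O, a, b, ha, hb⟩

theorem induces_iff {a : DoubleCone s} {ρ : 𝔄 →⋆ₐ[ℂ] 𝔄} :
    z.Induces a ρ ↔ ∀ O : DoubleCone s, ∀ x ∈ N.alg O, ∀ b : DoubleCone s, b.SpacelikeTo O →
      SemiconjBy (z.arrow a b : 𝔄) x (ρ x) := by
  simp_rw [semiconjBy_iff_mul_mul_star_eq (z.arrow a _).2, Induces, toFun_eq_arrow]
  constructor
  · intro h O x hx b hb
    obtain ⟨P, hP₁, hP₂⟩ := DoubleCone.exists_sup a b
    exact (h O x hx ⟨P, a, b, hP₁, hP₂⟩ rfl hb).symm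
  · rintro h O x hx b rfl hb
    exact (h O x hx b.face1 hb).symm

theorem commute_arrow (hs : 2 ≤ s) (hN : N.RelativeDuality) {O d e : DoubleCone s}
    (hd : d.SpacelikeTo O) (he : e.SpacelikeTo O) {x : 𝔄} (hx : x ∈ N.alg O) :
    Commute (z.arrow d e : 𝔄) x := by
  refine DoubleCone.SpacelikeTo.chain_induction hs (R := fun d e => Commute (z.arrow d e : 𝔄) x)
    ?_ ?_ hd he
  · intro d e f _ _ _ hde hef
    rw [← z.arrow_mul d e f, Submonoid.coe_mul]
    exact hde.mul_left hef
  · intro d e hde he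
    have hee := DoubleCone.Sub.refl e
    exact ⟨(hN.commute he hx (z.arrow_mem_alg hde hee)).symm,
      (hN.commute he hx (z.arrow_mem_alg hee hde)).symm⟩

theorem semiconjBy_arrow_congr (hs : 2 ≤ s) (hN : N.RelativeDuality) (a : DoubleCone s)
    {O d e : DoubleCone s} (hd : d.SpacelikeTo O) (he : e.SpacelikeTo O) {x y : 𝔄}
    (hx : x ∈ N.alg O) (h : SemiconjBy (z.arrow a d : 𝔄) x y) :
    SemiconjBy (z.arrow a e : 𝔄) x y := by
  rw [← z.arrow_mul a d e, Submonoid.coe_mul]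
  exact h.mul_left (z.commute_arrow hs hN hd he hx)

theorem exists_induces (hs : 2 ≤ s) (hN : N.RelativeDuality) (a : DoubleCone s) :
    ∃ ρ : 𝔄 →⋆ₐ[ℂ] 𝔄, z.Induces a ρ := by
  have := DoubleCone.neBot_spacelikeInfinity (show 0 < s by lia)
  let φ (b : DoubleCone s) : 𝔄 →⋆ₐ[ℂ] 𝔄 :=
    (Unitary.conjStarAlgAut ℂ 𝔄 (z.arrow a b)).toStarAlgHom
  have hφ (b : DoubleCone s) (x : 𝔄) : SemiconjBy (z.arrow a b : 𝔄) x (φ b x) :=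
    (semiconjBy_iff_mul_mul_star_eq (z.arrow a b).2).2 rfl
  have hev {O b : DoubleCone s} {x : 𝔄} (hx : x ∈ N.alg O) (hb : b.SpacelikeTo O) :
      ∀ᶠ c in DoubleCone.spacelikeInfinity s, φ b x = φ c x := by
    filter_upwards [DoubleCone.eventually_spacelikeTo O] with c hc
    exact ((semiconjBy_iff_mul_mul_star_eq (z.arrow a b).2).1
      (z.semiconjBy_arrow_congr hs hN a hc hb hx (hφ c x)))
  obtain ⟨ρ, hρ⟩ := exists_starAlgHom_tendsto_of_dense (φ := φ) N.dense fun x hx => by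
    obtain ⟨O, hO⟩ := Set.mem_iUnion.1 hx
    obtain ⟨b, hb⟩ := DoubleCone.exists_spacelikeTo (show 0 < s by lia) O
    exact ⟨φ b x, tendsto_const_nhds.congr' (hev hO hb)⟩
  refine ⟨ρ, z.induces_iff.2 fun O x hx b hb => ?_⟩
  rw [tendsto_nhds_unique (hρ x) (tendsto_const_nhds.congr' (hev hx hb))]
  exact hφ b x

variable {z}

theorem Induces.localizedIn {a : DoubleCone s} {ρ : 𝔄 →⋆ₐ[ℂ] 𝔄} (h : z.Induces a ρ) :
    N.LocalizedIn ρ a := fun O hO x hx => by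
  have : SemiconjBy (1 : 𝔄) x (ρ x) := by simpa using z.induces_iff.1 h O x hx a hO.symm
  simpa [SemiconjBy] using this.symm

theorem Induces.of_intertwines {a b : DoubleCone s} {ρ σ : 𝔄 →⋆ₐ[ℂ] 𝔄} (h : z.Induces a ρ)
    (hσ : Intertwines (z.arrow b a : 𝔄) ρ σ) : z.Induces b σ :=
  z.induces_iff.2 fun O x hx c hc => by
    rw [← z.arrow_mul b a c, Submonoid.coe_mul]
    exact (hσ x).mul_left (z.induces_iff.1 h O x hx c hc)

theorem Induces.transportable {a : DoubleCone s} {ρ : 𝔄 →⋆ₐ[ℂ] 𝔄} (h : z.Induces a ρ) :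
    N.Transportable ρ := fun b =>
  have hσ := Intertwines.conj (z.arrow b a) ρ
  ⟨_, (h.of_intertwines hσ).localizedIn, z.arrow b a, (z.arrow b a).2, hσ⟩

/-- The cocycle `z(b) = U(∂₀b) U(∂₁b)*` of a field `U` of unitaries transporting `ρ` to
endomorphisms `σ b` localized in `b`. -/
def ofTransport (hN : N.RelativeDuality) {ρ : 𝔄 →⋆ₐ[ℂ] 𝔄} {σ : DoubleCone s → 𝔄 →⋆ₐ[ℂ] 𝔄}
    {U : DoubleCone s → unitary 𝔄} (hσ : ∀ b, N.LocalizedIn (σ b) b)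
    (hU : ∀ b, Intertwines (U b : 𝔄) ρ (σ b)) : N.OneCocycle where
  toFun b := (U b.face0 * star (U b.face1) : unitary 𝔄)
  unitary_mem b := Subtype.prop _
  local_mem b := hN.intertwiner_mem ((hσ b.face1).mono b.sub1) ((hσ b.face0).mono b.sub0)
    ((hU b.face0).mul ((hU b.face1).star (U b.face1).2))
  cocycle c := by
    rw [← Submonoid.coe_mul]
    simp [TwoSimplex.face0, TwoSimplex.face1, TwoSimplex.face2, Unitary.star_eq_inv]

theorem induces_ofTransport (hN : N.RelativeDuality) {ρ : 𝔄 →⋆ₐ[ℂ] 𝔄}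
    {σ : DoubleCone s → 𝔄 →⋆ₐ[ℂ] 𝔄} {U : DoubleCone s → unitary 𝔄}
    (hσ : ∀ b, N.LocalizedIn (σ b) b) (hU : ∀ b, Intertwines (U b : 𝔄) ρ (σ b))
    {a : DoubleCone s} (ha : U a = 1) : (ofTransport hN hσ hU).Induces a ρ := by
  rintro O x hx b rfl hb
  refine ((semiconjBy_iff_mul_mul_star_eq (unitary_mem _ b)).1 ?_).symm
  have h := (hU b.face1).star (U b.face1).2 x
  rw [hσ b.face1 O hb.symm x hx] at h
  simpa [ofTransport, ha] using h

end OneCocycle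

theorem Transportable.exists_induces (hN : N.RelativeDuality) {ρ : 𝔄 →⋆ₐ[ℂ] 𝔄}
    {a : DoubleCone s} (hρ : N.LocalizedIn ρ a) (ht : N.Transportable ρ) :
    ∃ z : N.OneCocycle, z.Induces a ρ := by
  have transport (b : DoubleCone s) : ∃ (σ : 𝔄 →⋆ₐ[ℂ] 𝔄) (U : unitary 𝔄),
      N.LocalizedIn σ b ∧ Intertwines (U : 𝔄) ρ σ ∧ (b = a → U = 1) := by
    obtain rfl | hb := eq_or_ne b a
    · exact ⟨ρ, 1, hρ, Intertwines.one ρ, fun _ => rfl⟩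
    · obtain ⟨σ, hσ, U, hU, hUσ⟩ := ht b
      exact ⟨σ, ⟨U, hU⟩, hσ, hUσ, fun h => absurd h hb⟩
  choose σ U hσ hU hUa using transport
  exact ⟨_, OneCocycle.induces_ofTransport hN hσ hU (hUa a rfl)⟩

theorem Transportable.of_intertwines {ρ σ : 𝔄 →⋆ₐ[ℂ] 𝔄} (hρ : N.Transportable ρ) {U : 𝔄}
    (hU : U ∈ unitary 𝔄) (hUσ : Intertwines U ρ σ) : N.Transportable σ := fun O => by
  obtain ⟨τ, hτ, V, hV, hVτ⟩ := hρ O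
  exact ⟨τ, hτ, V * star U, mul_mem hV (Unitary.star_mem hU),
    Intertwines.mul hVτ (hUσ.star hU)⟩

namespace LocalizedIn

theorem map_intertwiner (hs : 2 ≤ s) (hN : N.RelativeDuality) {ρ σ τ : 𝔄 →⋆ₐ[ℂ] 𝔄}
    {c d e : DoubleCone s} (hρ : N.LocalizedIn ρ c) (hσ : N.LocalizedIn σ d)
    (hτ : N.LocalizedIn τ e) (hd : d.SpacelikeTo c) (he : e.SpacelikeTo c)
    (ht : N.Transportable σ) {T : 𝔄} (hT : Intertwines T σ τ) : ρ T = T := by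
  suffices h : ∀ (σ τ : 𝔄 →⋆ₐ[ℂ] 𝔄) (T : 𝔄), N.LocalizedIn σ d → N.LocalizedIn τ e →
      N.Transportable σ → Intertwines T σ τ → ρ T = T from h σ τ T hσ hτ ht hT
  refine DoubleCone.SpacelikeTo.chain_induction hs (R := fun d e => ∀ (σ τ : 𝔄 →⋆ₐ[ℂ] 𝔄) (T : 𝔄),
    N.LocalizedIn σ d → N.LocalizedIn τ e → N.Transportable σ → Intertwines T σ τ → ρ T = T)
    ?_ ?_ hd he
  · intro d e f _ _ _ hde hef σ τ T hσ hτ ht hT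
    obtain ⟨σ', hσ', V, hV, hVσ⟩ := ht e
    have hVfix : ρ V = V := hde σ σ' V hσ hσ' ht hVσ
    have hTVfix : ρ (T * star V) = T * star V :=
      hef σ' τ _ hσ' hτ (ht.of_intertwines hV hVσ) (hT.mul (Intertwines.star hVσ hV))
    have hTV : T = T * star V * V := by
      rw [mul_assoc, Unitary.star_mul_self_of_mem hV, mul_one]
    rw [hTV, map_mul, hTVfix, hVfix]
  · intro d e hde he
    exact ⟨fun σ τ T hσ hτ _ hT => hρ e he T (hN.intertwiner_mem (hσ.mono hde) hτ hT),
      fun σ τ T hσ hτ _ hT => hρ e he T (hN.intertwiner_mem hσ (hτ.mono hde) hT)⟩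

theorem comm (hs : 2 ≤ s) (hN : N.RelativeDuality) {ρ σ : 𝔄 →⋆ₐ[ℂ] 𝔄} {c d : DoubleCone s}
    (hρ : N.LocalizedIn ρ c) (hσ : N.LocalizedIn σ d) (hcd : c.SpacelikeTo d)
    (ht : N.Transportable σ) : ρ.comp σ = σ.comp ρ := by
  refine N.starAlgHom_ext fun O x hx => ?_
  obtain ⟨P, hOP, hcP⟩ := DoubleCone.exists_sup O c
  obtain ⟨e, he⟩ := DoubleCone.exists_spacelikeTo (show 0 < s by lia) P
  obtain ⟨σ', hσ', V, hV, hVσ⟩ := ht e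
  have hVfix : ρ V = V := hρ.map_intertwiner hs hN hσ hσ' hcd.symm (he.mono hcP) ht hVσ
  have hσ'x : σ' x = x := hσ' O (he.mono hOP).symm x hx
  have hσ'ρx : σ' (ρ x) = ρ x :=
    hσ' P he.symm (ρ x) (hN.localizedIn_map_mem hρ hcP (N.mono hOP hx))
  have hρσ : SemiconjBy V (ρ (σ x)) (ρ x) := by
    simpa only [hVfix, hσ'x] using SemiconjBy.map (hVσ x) ρ
  have hσρ : SemiconjBy V (σ (ρ x)) (ρ x) := by simpa only [hσ'ρx] using! hVσ (ρ x)
  exact eq_of_semiconjBy_of_mem_unitary hV hρσ hσρ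

end LocalizedIn

end Net

/-! ### The canonical permutation symmetry -/

namespace Net

namespace Tt

variable {s : ℕ} {𝔄 : Type u} [CStarAlgebra 𝔄] {N : Net s 𝔄}

theorem intertwines_elem {ρ σ : Tt N} (f : ρ ⟶ σ) : Intertwines (elem f) ρ.endo σ.endo :=
  elem_intertwines f

@[simp] theorem elem_adjoint {ρ σ : Tt N} (f : ρ ⟶ σ) : elem (adjoint f) = star (elem f) := rfl

@[simp] theorem elem_associator_inv (ρ σ τ : Tt N) : elem (α_ ρ σ τ).inv = 1 := rfl

theorem exists_localizedIn (ρ : Tt N) (O : DoubleCone s) :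
    ∃ (σ : Tt N) (U : ρ ⟶ σ), N.LocalizedIn σ.endo O ∧ elem U ∈ unitary 𝔄 := by
  obtain ⟨σ, hσ, U, hU, hUσ⟩ := ρ.transportable O
  exact ⟨⟨σ, ⟨O, hσ⟩, ρ.transportable.of_intertwines hU hUσ⟩, ofElem U hUσ, hσ, hU⟩

theorem exists_localizedIn_spacelikeTo (hs : 0 < s) (σ : Tt N) (c : DoubleCone s) :
    ∃ (d : DoubleCone s) (τ : Tt N) (U : σ ⟶ τ), d.SpacelikeTo c ∧ N.LocalizedIn τ.endo d ∧
      elem U ∈ unitary 𝔄 := by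
  obtain ⟨d, hd⟩ := DoubleCone.exists_spacelikeTo hs c
  obtain ⟨τ, U, hτ, hU⟩ := exists_localizedIn σ d
  exact ⟨d, τ, U, hd, hτ, hU⟩

/-- The element `(U₂ ⊗ U₁)* (U₁ ⊗ U₂)` of `(ρ ⊗ σ, σ ⊗ ρ)`. It is the canonical permutation
symmetry when `U₁` and `U₂` are unitaries whose targets are localized in spacelike separated double
cones. -/
def exchange {ρ σ ρ₁ σ₂ : Tt N} (U₁ : ρ ⟶ ρ₁) (U₂ : σ ⟶ σ₂) : 𝔄 :=
  star (elem (U₂ ⊗ₘ U₁)) * elem (U₁ ⊗ₘ U₂)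

theorem star_exchange {ρ σ ρ₁ σ₂ : Tt N} (U₁ : ρ ⟶ ρ₁) (U₂ : σ ⟶ σ₂) :
    star (exchange U₁ U₂) = exchange U₂ U₁ := by
  rw [exchange, star_mul, star_star, exchange]

theorem exchange_comp_right {ρ σ ρ₁ σ₂ σ₃ : Tt N} (U₁ : ρ ⟶ ρ₁) (U₂ : σ ⟶ σ₂) {W : σ₂ ⟶ σ₃}
    (hW : elem W ∈ unitary 𝔄) (hfix : ρ₁.endo (elem W) = elem W) :
    exchange U₁ (U₂ ≫ W) = exchange U₁ U₂ := by
  have left : elem ((U₂ ≫ W) ⊗ₘ U₁) = elem W * elem (U₂ ⊗ₘ U₁) := mul_assoc _ _ _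
  have right : elem (U₁ ⊗ₘ (U₂ ≫ W)) = elem W * elem (U₁ ⊗ₘ U₂) := by
    rw [elem_tensorHom, elem_comp, map_mul, ← mul_assoc, elem_intertwines, hfix, mul_assoc,
      elem_tensorHom]
  rw [exchange, left, right, star_mul, mul_assoc, ← mul_assoc (star (elem W)),
    Unitary.star_mul_self_of_mem hW, one_mul, exchange]

section

variable (hs : 2 ≤ s) (hN : N.RelativeDuality)
include hs hN

theorem exchange_congr_right {ρ σ ρ₁ σ₂ σ₃ : Tt N} {c d e : DoubleCone s} (hd : d.SpacelikeTo c)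
    (he : e.SpacelikeTo c) (hρ₁ : N.LocalizedIn ρ₁.endo c) (hσ₂ : N.LocalizedIn σ₂.endo d)
    (hσ₃ : N.LocalizedIn σ₃.endo e) (U₁ : ρ ⟶ ρ₁) {U₂ : σ ⟶ σ₂} {U₃ : σ ⟶ σ₃}
    (h₂ : elem U₂ ∈ unitary 𝔄) (h₃ : elem U₃ ∈ unitary 𝔄) : exchange U₁ U₂ = exchange U₁ U₃ := by
  let W : σ₂ ⟶ σ₃ := adjoint U₂ ≫ U₃
  have hW : elem W ∈ unitary 𝔄 := mul_mem h₃ (Unitary.star_mem h₂)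
  have hU₂W : U₂ ≫ W = U₃ := hom_ext (by
    simp only [W, elem_comp, elem_adjoint, mul_assoc, Unitary.star_mul_self_of_mem h₂, mul_one])
  rw [← hU₂W, exchange_comp_right U₁ U₂ hW]
  exact hρ₁.map_intertwiner hs hN hσ₂ hσ₃ hd he σ₂.transportable (intertwines_elem W)

theorem exchange_congr_left {ρ σ ρ₁ σ₂ ρ₃ : Tt N} {c d e : DoubleCone s} (hd : d.SpacelikeTo c)
    (he : e.SpacelikeTo c) (hσ₂ : N.LocalizedIn σ₂.endo c) (hρ₁ : N.LocalizedIn ρ₁.endo d)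
    (hρ₃ : N.LocalizedIn ρ₃.endo e) (U₂ : σ ⟶ σ₂) {U₁ : ρ ⟶ ρ₁} {U₃ : ρ ⟶ ρ₃}
    (h₁ : elem U₁ ∈ unitary 𝔄) (h₃ : elem U₃ ∈ unitary 𝔄) : exchange U₁ U₂ = exchange U₃ U₂ := by
  rw [← star_exchange U₂, exchange_congr_right hs hN hd he hσ₂ hρ₁ hρ₃ U₂ h₁ h₃, star_exchange]

theorem exchange_congr {ρ σ ρ₁ σ₂ ρ₃ σ₄ : Tt N} {O₁ O₂ O₃ O₄ : DoubleCone s}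
    (h₁₂ : O₁.SpacelikeTo O₂) (h₃₄ : O₃.SpacelikeTo O₄)
    (hρ₁ : N.LocalizedIn ρ₁.endo O₁) (hσ₂ : N.LocalizedIn σ₂.endo O₂)
    (hρ₃ : N.LocalizedIn ρ₃.endo O₃) (hσ₄ : N.LocalizedIn σ₄.endo O₄)
    {U₁ : ρ ⟶ ρ₁} {U₂ : σ ⟶ σ₂} {U₃ : ρ ⟶ ρ₃} {U₄ : σ ⟶ σ₄}
    (h₁ : elem U₁ ∈ unitary 𝔄) (h₂ : elem U₂ ∈ unitary 𝔄)
    (h₃ : elem U₃ ∈ unitary 𝔄) (h₄ : elem U₄ ∈ unitary 𝔄) :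
    exchange U₁ U₂ = exchange U₃ U₄ := by
  obtain ⟨P, hP₁, hP₃⟩ := DoubleCone.exists_sup O₁ O₃
  obtain ⟨e, τ, V, he, hτ, hV⟩ := exists_localizedIn_spacelikeTo (by lia) σ P
  calc exchange U₁ U₂ = exchange U₁ V :=
        exchange_congr_right hs hN h₁₂.symm (he.mono hP₁) hρ₁ hσ₂ hτ U₁ h₂ hV
    _ = exchange U₃ V :=
        exchange_congr_left hs hN (he.mono hP₁).symm (he.mono hP₃).symm hτ hρ₁ hρ₃ V h₁ h₃
    _ = exchange U₃ U₄ :=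
        exchange_congr_right hs hN (he.mono hP₃) h₃₄.symm hρ₃ hτ hσ₄ U₃ hV h₄

theorem exists_eq_exchange (ρ σ : Tt N) :
    ∃ T : 𝔄, ∀ (ρ₁ σ₂ : Tt N) (O₁ O₂ : DoubleCone s), O₁.SpacelikeTo O₂ →
      N.LocalizedIn ρ₁.endo O₁ → N.LocalizedIn σ₂.endo O₂ →
      ∀ (U₁ : ρ ⟶ ρ₁) (U₂ : σ ⟶ σ₂), elem U₁ ∈ unitary 𝔄 → elem U₂ ∈ unitary 𝔄 →
        T = exchange U₁ U₂ := by
  obtain ⟨c, hc⟩ := ρ.localized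
  obtain ⟨d, τ, V, hd, hτ, hV⟩ := exists_localizedIn_spacelikeTo (by lia) σ c
  exact ⟨exchange (𝟙 ρ) V, fun ρ₁ σ₂ O₁ O₂ h hρ₁ hσ₂ U₁ U₂ h₁ h₂ =>
    exchange_congr hs hN hd.symm h hc hτ hρ₁ hσ₂ (one_mem _) hV h₁ h₂⟩

end

/-- The element `ε(ρ, σ)` of the canonical permutation symmetry. -/
def permutation (hs : 2 ≤ s) (hN : N.RelativeDuality) (ρ σ : Tt N) : 𝔄 :=
  (exists_eq_exchange hs hN ρ σ).choose

section

variable (hs : 2 ≤ s) (hN : N.RelativeDuality)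

theorem permutation_eq_exchange {ρ σ ρ₁ σ₂ : Tt N} {O₁ O₂ : DoubleCone s}
    (h : O₁.SpacelikeTo O₂) (hρ₁ : N.LocalizedIn ρ₁.endo O₁) (hσ₂ : N.LocalizedIn σ₂.endo O₂)
    {U₁ : ρ ⟶ ρ₁} {U₂ : σ ⟶ σ₂} (h₁ : elem U₁ ∈ unitary 𝔄) (h₂ : elem U₂ ∈ unitary 𝔄) :
    permutation hs hN ρ σ = exchange U₁ U₂ :=
  (exists_eq_exchange hs hN ρ σ).choose_spec ρ₁ σ₂ O₁ O₂ h hρ₁ hσ₂ U₁ U₂ h₁ h₂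

theorem permutation_eq_star_mul {ρ σ τ : Tt N} {c d : DoubleCone s} (h : d.SpacelikeTo c)
    (hρ : N.LocalizedIn ρ.endo c) (hτ : N.LocalizedIn τ.endo d) {U : σ ⟶ τ}
    (hU : elem U ∈ unitary 𝔄) : permutation hs hN ρ σ = star (elem U) * ρ.endo (elem U) := by
  rw [permutation_eq_exchange hs hN h.symm hρ hτ (U₁ := 𝟙 ρ) (one_mem _) hU]
  simp [exchange]

theorem star_permutation (ρ σ : Tt N) :
    star (permutation hs hN ρ σ) = permutation hs hN σ ρ := by
  obtain ⟨c, hc⟩ := ρ.localized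
  obtain ⟨d, τ, U, hd, hτ, hU⟩ := exists_localizedIn_spacelikeTo (by lia) σ c
  rw [permutation_eq_exchange hs hN hd.symm hc hτ (U₁ := 𝟙 ρ) (one_mem _) hU, star_exchange,
    permutation_eq_exchange hs hN hd hτ hc hU (U₂ := 𝟙 ρ) (one_mem _)]

theorem permutation_mem_unitary (ρ σ : Tt N) : permutation hs hN ρ σ ∈ unitary 𝔄 := by
  obtain ⟨c, hc⟩ := ρ.localized
  obtain ⟨d, τ, U, hd, hτ, hU⟩ := exists_localizedIn_spacelikeTo (by lia) σ c
  rw [permutation_eq_star_mul hs hN hd hc hτ hU]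
  exact mul_mem (Unitary.star_mem hU) (Unitary.map_mem ρ.endo hU)

theorem permutation_mul_permutation (ρ σ : Tt N) :
    permutation hs hN σ ρ * permutation hs hN ρ σ = 1 := by
  rw [← star_permutation, Unitary.star_mul_self_of_mem (permutation_mem_unitary hs hN ρ σ)]

theorem intertwines_permutation (ρ σ : Tt N) :
    Intertwines (permutation hs hN ρ σ) (ρ ⊗ σ).endo (σ ⊗ ρ).endo := by
  obtain ⟨c, hc⟩ := ρ.localized
  obtain ⟨d, τ, U, hd, hτ, hU⟩ := exists_localizedIn_spacelikeTo (by lia) σ c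
  rw [permutation_eq_star_mul hs hN hd hc hτ hU]
  have hρU : Intertwines (ρ.endo (elem U)) (ρ ⊗ σ).endo (τ.endo.comp ρ.endo) := by
    rw [← hc.comm hs hN hτ hd.symm τ.transportable]
    exact fun x => (intertwines_elem U x).map ρ.endo
  have hUstar : Intertwines (star (elem U)) (τ.endo.comp ρ.endo) (σ ⊗ ρ).endo :=
    fun x => (intertwines_elem U).star hU (ρ.endo x)
  exact hUstar.mul hρU

theorem permutation_naturality_left {ρ ρ' : Tt N} (f : ρ ⟶ ρ') (σ : Tt N) :
    permutation hs hN ρ' σ * elem f = σ.endo (elem f) * permutation hs hN ρ σ := by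
  obtain ⟨c, hc⟩ := ρ.localized
  obtain ⟨c', hc'⟩ := ρ'.localized
  obtain ⟨P, hP, hP'⟩ := DoubleCone.exists_sup c c'
  obtain ⟨d, τ, U, hd, hτ, hU⟩ := exists_localizedIn_spacelikeTo (by lia) σ P
  rw [permutation_eq_star_mul hs hN hd (hc.mono hP) hτ hU,
    permutation_eq_star_mul hs hN hd (hc'.mono hP') hτ hU]
  have hτf : τ.endo (elem f) = elem f :=
    hτ P hd.symm _ (hN.intertwiner_mem (hc.mono hP) (hc'.mono hP') (intertwines_elem f))
  have hUf : star (elem U) * elem f = σ.endo (elem f) * star (elem U) := by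
    simpa only [hτf] using! (intertwines_elem U).star hU (elem f)
  rw [mul_assoc, ← elem_intertwines f, ← mul_assoc, hUf, mul_assoc]

theorem permutation_naturality_right (ρ : Tt N) {σ σ' : Tt N} (g : σ ⟶ σ') :
    permutation hs hN ρ σ' * ρ.endo (elem g) = elem g * permutation hs hN ρ σ := by
  have h := congrArg star (permutation_naturality_left hs hN (adjoint g) ρ)
  rw [star_mul, star_mul, ← map_star, star_permutation, star_permutation, elem_adjoint,
    star_star] at h
  exact h.symm

theorem permutation_tensor_left (ρ ρ' σ : Tt N) :
    permutation hs hN (ρ ⊗ ρ') σ =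
      permutation hs hN ρ σ * ρ.endo (permutation hs hN ρ' σ) := by
  obtain ⟨c, hc⟩ := ρ.localized
  obtain ⟨c', hc'⟩ := ρ'.localized
  obtain ⟨P, hP, hP'⟩ := DoubleCone.exists_sup c c'
  obtain ⟨d, τ, U, hd, hτ, hU⟩ := exists_localizedIn_spacelikeTo (by lia) σ P
  have hρρ' : N.LocalizedIn (ρ ⊗ ρ').endo P := (hc.mono hP).comp (hc'.mono hP')
  rw [permutation_eq_star_mul hs hN hd (hc.mono hP) hτ hU,
    permutation_eq_star_mul hs hN hd (hc'.mono hP') hτ hU,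
    permutation_eq_star_mul hs hN hd hρρ' hτ hU, map_mul, mul_assoc, ← mul_assoc (ρ.endo _),
    ← map_mul, Unitary.mul_star_self_of_mem hU, map_one, one_mul, endo_tensor,
    StarAlgHom.comp_apply]

theorem permutation_tensor_right (ρ σ σ' : Tt N) :
    permutation hs hN ρ (σ ⊗ σ') =
      σ.endo (permutation hs hN ρ σ') * permutation hs hN ρ σ := by
  have h := congrArg star (permutation_tensor_left hs hN σ σ' ρ)
  rwa [star_mul, ← map_star, star_permutation, star_permutation, star_permutation] at h

/-- The isomorphism given by a unitary intertwiner. -/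
def isoOfUnitary {ρ σ : Tt N} {T : 𝔄} (hT : T ∈ unitary 𝔄) (h : Intertwines T ρ.endo σ.endo) :
    ρ ≅ σ where
  hom := ofElem T h
  inv := ofElem (star T) (h.star hT)
  hom_inv_id := hom_ext (Unitary.star_mul_self_of_mem hT)
  inv_hom_id := hom_ext (Unitary.mul_star_self_of_mem hT)

@[simp] theorem elem_isoOfUnitary_hom {ρ σ : Tt N} {T : 𝔄} (hT : T ∈ unitary 𝔄)
    (h : Intertwines T ρ.endo σ.endo) : elem (isoOfUnitary hT h).hom = T := rfl

/-- The canonical permutation symmetry of `𝒯_t(𝔄)`. -/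
@[reducible] def canonicalSymmetry : SymmetricCategory (Tt N) where
  braiding ρ σ :=
    isoOfUnitary (permutation_mem_unitary hs hN ρ σ) (intertwines_permutation hs hN ρ σ)
  braiding_naturality_right ρ _ _ g := hom_ext (permutation_naturality_right hs hN ρ g)
  braiding_naturality_left f σ := hom_ext (permutation_naturality_left hs hN f σ)
  hexagon_forward ρ σ τ := hom_ext (by simpa using permutation_tensor_right hs hN ρ σ τ)
  hexagon_reverse ρ σ τ := hom_ext (by simpa using permutation_tensor_left hs hN ρ σ τ)
  symmetry ρ σ := hom_ext (permutation_mul_permutation hs hN ρ σ)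

theorem isCanonicalSymmetry_canonicalSymmetry :
    IsCanonicalSymmetry N (canonicalSymmetry hs hN) :=
  fun _ _ _ _ _ _ h hρ₁ hσ₂ _ _ h₁ h₂ => permutation_eq_exchange hs hN h hρ₁ hσ₂ h₁ h₂

end

end Tt

end Net

/-! ### Extension of endomorphisms along an inclusion of nets -/

namespace Net

namespace Inclusion

variable {s : ℕ} {𝔄 : Type u} [CStarAlgebra 𝔄] {𝔅 : Type v} [CStarAlgebra 𝔅]
  {A : Net s 𝔄} {B : Net s 𝔅} {i : A.Inclusion B}

theorem commute_hom (i : A.Inclusion B) (hB : B.RelativeDuality) {O b : DoubleCone s}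
    (hb : b.SpacelikeTo O) {x : 𝔄} (hx : x ∈ A.alg b) {X : 𝔅} (hX : X ∈ B.alg O) :
    Commute (i.hom x) X :=
  (hB.commute hb hX (i.map_mem b x hx)).symm

/-- `ψ` is the canonical extension to `𝔅` of the endomorphism `ρ` of `𝔄`: every intertwiner from
`ρ` to an endomorphism localized in `b ⊆ O'` intertwines `ψ` with the identity on `𝔅(O)`. Applied
to a unitary `U ∈ (ρ, σ)`, this is the formula `ψ(X) = U* X U` for `X ∈ 𝔅(O)`. -/
def IsExtension (i : A.Inclusion B) (ρ : 𝔄 →⋆ₐ[ℂ] 𝔄) (ψ : 𝔅 →⋆ₐ[ℂ] 𝔅) : Prop :=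
  ∀ ⦃O b : DoubleCone s⦄, b.SpacelikeTo O → ∀ ⦃σ : 𝔄 →⋆ₐ[ℂ] 𝔄⦄, A.LocalizedIn σ b →
    ∀ ⦃T : 𝔄⦄, Intertwines T ρ σ → ∀ ⦃X : 𝔅⦄, X ∈ B.alg O → SemiconjBy (i.hom T) (ψ X) X

namespace IsExtension

variable {ρ σ : 𝔄 →⋆ₐ[ℂ] 𝔄} {ψ χ : 𝔅 →⋆ₐ[ℂ] 𝔅}

theorem of_transport (hA : A.RelativeDuality) (hB : B.RelativeDuality)
    (h : ∀ O b : DoubleCone s, b.SpacelikeTo O → ∃ (σ : 𝔄 →⋆ₐ[ℂ] 𝔄) (U : 𝔄), A.LocalizedIn σ b ∧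
      U ∈ unitary 𝔄 ∧ Intertwines U ρ σ ∧ ∀ X ∈ B.alg O, SemiconjBy (i.hom U) (ψ X) X) :
    i.IsExtension ρ ψ := by
  intro O b hb τ hτ T hT X hX
  obtain ⟨σ, U, hσ, hU, hUσ, hUψ⟩ := h O b hb
  have hTU : T * star U ∈ A.alg b := hA.intertwiner_mem hσ hτ (hT.mul (hUσ.star hU))
  have hcomm : SemiconjBy (i.hom (T * star U * U)) (ψ X) X := by
    rw [map_mul]
    exact SemiconjBy.mul_left (i.commute_hom hB hb hTU hX) (hUψ X hX)
  rwa [mul_assoc, Unitary.star_mul_self_of_mem hU, mul_one] at hcomm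

theorem of_induces (hA : A.RelativeDuality) (hB : B.RelativeDuality) {z : A.OneCocycle}
    {a : DoubleCone s} (hψ : (z.map i).Induces a ψ) (hρ : z.Induces a ρ) :
    i.IsExtension ρ ψ := by
  refine of_transport hA hB fun O b hb => ?_
  have hσ := Intertwines.conj (z.arrow b a) ρ
  refine ⟨_, z.arrow b a, (hρ.of_intertwines hσ).localizedIn, (z.arrow b a).2, hσ, fun X hX => ?_⟩
  exact (z.map i).semiconjBy_arrow_symm ((z.map i).induces_iff.1 hψ O X hX b hb)

theorem localizedIn (hψ : i.IsExtension ρ ψ) {a : DoubleCone s} (ha : A.LocalizedIn ρ a) :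
    B.LocalizedIn ψ a := fun O hO X hX => by
  simpa [SemiconjBy] using hψ hO.symm ha (Intertwines.one ρ) hX

theorem induces (hψ : i.IsExtension ρ ψ) {z : A.OneCocycle} {a : DoubleCone s}
    (hz : z.Induces a ρ) : (z.map i).Induces a ψ := by
  refine (z.map i).induces_iff.2 fun O X hX b hb => ?_
  have hσ := Intertwines.conj (z.arrow b a) ρ
  exact (z.map i).semiconjBy_arrow_symm (hψ hb (hz.of_intertwines hσ).localizedIn hσ hX)

theorem intertwines (hs : 0 < s) (hψ : i.IsExtension ρ ψ) (hχ : i.IsExtension σ χ)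
    (hσ : A.Transportable σ) {T : 𝔄} (hT : Intertwines T ρ σ) : Intertwines (i.hom T) ψ χ := by
  refine congrFun (B.continuous_ext (continuous_const.mul (map_continuous ψ))
    ((map_continuous χ).mul continuous_const) fun O X hX => ?_)
  obtain ⟨b, hb⟩ := DoubleCone.exists_spacelikeTo hs O
  obtain ⟨σ', hσ', V, hV, hVσ⟩ := hσ b
  have hVT : SemiconjBy (i.hom (V * T)) (ψ X) X := hψ hb hσ' (Intertwines.mul hVσ hT) hX
  have hVχ : SemiconjBy (star (i.hom V)) X (χ X) :=
    semiconjBy_star_of_mem_unitary (Unitary.map_mem i.hom hV) (hχ hb hσ' hVσ hX)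
  have hTV : star (i.hom V) * i.hom (V * T) = i.hom T := by
    rw [← map_star, ← map_mul, ← mul_assoc, Unitary.star_mul_self_of_mem hV, one_mul]
  exact hTV ▸ hVχ.mul_left hVT

theorem unique (hs : 0 < s) (hψ : i.IsExtension ρ ψ) (hχ : i.IsExtension ρ χ)
    (hρ : A.Transportable ρ) : ψ = χ :=
  StarAlgHom.ext fun X => by
    simpa [SemiconjBy] using hψ.intertwines hs hχ hρ (Intertwines.one ρ) X

theorem apply_hom (hs : 0 < s) (hψ : i.IsExtension ρ ψ) (hρ : A.Transportable ρ) (x : 𝔄) :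
    ψ (i.hom x) = i.hom (ρ x) := by
  suffices h : ψ.comp i.hom = i.hom.comp ρ from DFunLike.congr_fun h x
  refine A.starAlgHom_ext fun O x hx => ?_
  obtain ⟨b, hb⟩ := DoubleCone.exists_spacelikeTo hs O
  obtain ⟨ρ', hρ', V, hV, hVρ⟩ := hρ b
  have hVψ : SemiconjBy (i.hom V) (ψ (i.hom x)) (i.hom x) := hψ hb hρ' hVρ (i.map_mem O x hx)
  have hVx : SemiconjBy V (ρ x) x := by simpa only [hρ' O hb.symm x hx] using! hVρ x
  exact eq_of_semiconjBy_of_mem_unitary (Unitary.map_mem i.hom hV) hVψ (hVx.map i.hom)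

theorem id (hA : A.RelativeDuality) (hB : B.RelativeDuality) :
    i.IsExtension (StarAlgHom.id ℂ 𝔄) (StarAlgHom.id ℂ 𝔅) :=
  of_transport hA hB fun _ _ _ => ⟨StarAlgHom.id ℂ 𝔄, 1, fun _ _ _ _ => rfl, one_mem _,
    Intertwines.one _, fun X _ => by simp⟩

theorem comp (hs : 0 < s) (hA : A.RelativeDuality) (hB : B.RelativeDuality)
    (hψ : i.IsExtension ρ ψ) (hχ : i.IsExtension σ χ) (hρ : A.Transportable ρ)
    (hσ : A.Transportable σ) : i.IsExtension (ρ.comp σ) (ψ.comp χ) := by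
  refine of_transport hA hB fun O b hb => ?_
  obtain ⟨ρ', hρ', U, hU, hUρ⟩ := hρ b
  obtain ⟨σ', hσ', V, hV, hVσ⟩ := hσ b
  refine ⟨ρ'.comp σ', U * ρ V, hρ'.comp hσ', mul_mem hU (Unitary.map_mem ρ hV),
    Intertwines.comp hUρ hVσ, fun X hX => ?_⟩
  rw [map_mul, ← hψ.apply_hom hs hρ]
  exact (hψ hb hρ' hUρ hX).mul_left ((hχ hb hσ' hVσ hX).map ψ)

end IsExtension

theorem exists_isExtension (i : A.Inclusion B) (hs : 2 ≤ s) (hA : A.RelativeDuality)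
    (hB : B.RelativeDuality) {ρ : 𝔄 →⋆ₐ[ℂ] 𝔄} {a : DoubleCone s} (ha : A.LocalizedIn ρ a)
    (hρ : A.Transportable ρ) : ∃ ψ, i.IsExtension ρ ψ := by
  obtain ⟨z, hz⟩ := hρ.exists_induces hA ha
  obtain ⟨ψ, hψ⟩ := (z.map i).exists_induces hs hB a
  exact ⟨ψ, IsExtension.of_induces hA hB hψ hz⟩

variable (i) (hs : 2 ≤ s) (hA : A.RelativeDuality) (hB : B.RelativeDuality)

/-- The endomorphism of `𝔅` underlying the image of an object of `𝒯_t(𝔄)` under the extension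
functor. -/
def extendEndo (ρ : A.Tt) : 𝔅 →⋆ₐ[ℂ] 𝔅 :=
  (i.exists_isExtension hs hA hB ρ.localized.choose_spec ρ.transportable).choose

theorem isExtension_extendEndo (ρ : A.Tt) : i.IsExtension ρ.endo (i.extendEndo hs hA hB ρ) :=
  (i.exists_isExtension hs hA hB ρ.localized.choose_spec ρ.transportable).choose_spec

theorem intertwines_extendEndo {ρ σ : A.Tt} (T : ρ ⟶ σ) : Intertwines (i.hom (Tt.elem T))
    (i.extendEndo hs hA hB ρ) (i.extendEndo hs hA hB σ) :=
  (i.isExtension_extendEndo hs hA hB ρ).intertwines (by lia) (i.isExtension_extendEndo hs hA hB σ)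
    σ.transportable (Tt.intertwines_elem T)

/-- The extension functor `𝒯_t(𝔄) ⥤ 𝒯_t(𝔅)` of an inclusion of nets satisfying relative
duality. -/
def extension : A.Tt ⥤ B.Tt where
  obj ρ :=
    { endo := i.extendEndo hs hA hB ρ
      localized := ρ.localized.imp fun _ => (i.isExtension_extendEndo hs hA hB ρ).localizedIn
      transportable := fun O => by
        obtain ⟨σ, U, hσ, hU⟩ := ρ.exists_localizedIn O
        exact ⟨i.extendEndo hs hA hB σ, (i.isExtension_extendEndo hs hA hB σ).localizedIn hσ,
          i.hom (Tt.elem U), Unitary.map_mem i.hom hU, i.intertwines_extendEndo hs hA hB U⟩ }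
  map T := Tt.ofElem (i.hom (Tt.elem T)) (i.intertwines_extendEndo hs hA hB T)
  map_id _ := Tt.hom_ext (map_one i.hom)
  map_comp S T := Tt.hom_ext (map_mul i.hom (Tt.elem T) (Tt.elem S))

theorem isExtension_extension_obj (ρ : A.Tt) :
    i.IsExtension ρ.endo ((i.extension hs hA hB).obj ρ).endo :=
  i.isExtension_extendEndo hs hA hB ρ

@[simp] theorem elem_extension_map {ρ σ : A.Tt} (T : ρ ⟶ σ) :
    Tt.elem ((i.extension hs hA hB).map T) = i.hom (Tt.elem T) := rfl

@[simp] theorem extension_obj_endo_hom (ρ : A.Tt) (x : 𝔄) :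
    ((i.extension hs hA hB).obj ρ).endo (i.hom x) = i.hom (ρ.endo x) :=
  (i.isExtension_extension_obj hs hA hB ρ).apply_hom (by lia) ρ.transportable x

theorem extension_obj_injective : Function.Injective (i.extension hs hA hB).obj := by
  intro ρ σ h
  refine Tt.ext (StarAlgHom.ext fun x => i.injective ?_)
  rw [← i.extension_obj_endo_hom hs hA hB, h, i.extension_obj_endo_hom hs hA hB]

instance : (i.extension hs hA hB).Faithful where
  map_injective h := Tt.hom_ext (i.injective (congrArg Tt.elem h))

instance : (i.extension hs hA hB).Additive where
  map_add := Tt.hom_ext (map_add i.hom _ _)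

instance : (i.extension hs hA hB).Linear ℂ where
  map_smul T c := Tt.hom_ext (map_smul i.hom c (Tt.elem T))

theorem extension_map_adjoint {ρ σ : A.Tt} (T : ρ ⟶ σ) :
    (i.extension hs hA hB).map (Tt.adjoint T) = Tt.adjoint ((i.extension hs hA hB).map T) :=
  Tt.hom_ext (map_star i.hom (Tt.elem T))

theorem norm_extension_map {ρ σ : A.Tt} (T : ρ ⟶ σ) : ‖(i.extension hs hA hB).map T‖ = ‖T‖ :=
  NonUnitalStarAlgHom.norm_map i.hom i.injective (Tt.elem T)

theorem extension_obj_tensor (ρ σ : A.Tt) : (i.extension hs hA hB).obj (ρ ⊗ σ) =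
    (i.extension hs hA hB).obj ρ ⊗ (i.extension hs hA hB).obj σ :=
  Tt.ext ((i.isExtension_extension_obj hs hA hB (ρ ⊗ σ)).unique (by lia)
    ((i.isExtension_extension_obj hs hA hB ρ).comp (by lia) hA hB
      (i.isExtension_extension_obj hs hA hB σ) ρ.transportable σ.transportable)
    (ρ ⊗ σ).transportable)

theorem extension_obj_unit : (i.extension hs hA hB).obj (𝟙_ A.Tt) = 𝟙_ B.Tt :=
  Tt.ext ((i.isExtension_extension_obj hs hA hB (𝟙_ A.Tt)).unique (by lia)
    (IsExtension.id hA hB) (𝟙_ A.Tt).transportable)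

theorem elem_extension_map_tensorHom {ρ ρ' σ σ' : A.Tt} (S : ρ ⟶ ρ') (T : σ ⟶ σ') :
    Tt.elem ((i.extension hs hA hB).map (S ⊗ₘ T)) =
      Tt.elem ((i.extension hs hA hB).map S ⊗ₘ (i.extension hs hA hB).map T) := by
  simp

theorem hom_permutation (ρ σ : A.Tt) : i.hom (Tt.permutation hs hA ρ σ) =
    Tt.permutation hs hB ((i.extension hs hA hB).obj ρ) ((i.extension hs hA hB).obj σ) := by
  obtain ⟨c, hc⟩ := ρ.localized
  obtain ⟨d, τ, U, hd, hτ, hU⟩ := Tt.exists_localizedIn_spacelikeTo (by lia) σ c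
  rw [Tt.permutation_eq_star_mul hs hA hd hc hτ hU,
    Tt.permutation_eq_star_mul hs hB hd
      ((i.isExtension_extension_obj hs hA hB ρ).localizedIn hc)
      ((i.isExtension_extension_obj hs hA hB τ).localizedIn hτ)
      (U := (i.extension hs hA hB).map U) (Unitary.map_mem i.hom hU),
    elem_extension_map, extension_obj_endo_hom, map_mul, map_star]

/-- The strict monoidal structure of the extension functor. Its structure isomorphisms relate
objects that are equal only propositionally; as elements of `𝔅` they are `1`. -/
def extensionCoreMonoidal : (i.extension hs hA hB).CoreMonoidal where
  εIso := Tt.isoOfUnitary (one_mem _) (i.extension_obj_unit hs hA hB ▸ Intertwines.one _)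
  μIso ρ σ := Tt.isoOfUnitary (one_mem _) (i.extension_obj_tensor hs hA hB ρ σ ▸ Intertwines.one _)
  μIso_hom_natural_left f σ := Tt.hom_ext (by simp)
  μIso_hom_natural_right ρ g := Tt.hom_ext (by simp)
  associativity ρ σ τ := Tt.hom_ext (by simp)
  left_unitality ρ := Tt.hom_ext (by simp)
  right_unitality ρ := Tt.hom_ext (by simp)

/-- The extension functor is braided for the canonical permutation symmetries. -/
@[reducible] def extensionBraided :
    letI := Tt.canonicalSymmetry hs hA
    letI := Tt.canonicalSymmetry hs hB
    (i.extension hs hA hB).Braided :=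
  letI := Tt.canonicalSymmetry hs hA
  letI := Tt.canonicalSymmetry hs hB
  { toMonoidal := (i.extensionCoreMonoidal hs hA hB).toMonoidal
    braided := fun ρ σ => Tt.hom_ext
      ((mul_one _).trans ((i.hom_permutation hs hA hB ρ σ).trans (one_mul _).symm)) }

end Inclusion

end Net

end

theorem theorem2p2 {s : ℕ} (hs : 2 ≤ s) {𝔄 : Type u} [CStarAlgebra 𝔄] {𝔅 : Type v}
    [CStarAlgebra 𝔅] (A : Net s 𝔄) (B : Net s 𝔅) (i : A.Inclusion B)
    (hA : A.RelativeDuality) (hB : B.RelativeDuality) :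
    -- every cocycle of `A` defines a field of objects of `𝒯_t(A)`, `ρ_a` being localized in `a`
    (∀ (z : A.OneCocycle) (a : DoubleCone s),
      ∃ ρ : A.Tt, A.LocalizedIn ρ.endo a ∧ z.Induces a ρ.endo) ∧
    -- and every object of `𝒯_t(A)` localized in `a` arises in this way
    (∀ (ρ : A.Tt) (a : DoubleCone s), A.LocalizedIn ρ.endo a →
      ∃ z : A.OneCocycle, z.Induces a ρ.endo) ∧
    -- the categories carry their canonical permutation symmetries
    ∃ (εA : SymmetricCategory A.Tt) (εB : SymmetricCategory B.Tt),
      Net.Tt.IsCanonicalSymmetry A εA ∧ Net.Tt.IsCanonicalSymmetry B εB ∧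
      ∃ (F : A.Tt ⥤ B.Tt) (_ : F.Braided),
        -- on objects: the extension of endomorphisms through cocycles
        (∀ (ρ : A.Tt) (x : 𝔄), (F.obj ρ).endo (i.hom x) = i.hom (ρ.endo x)) ∧
        (∀ (ρ : A.Tt) (z : A.OneCocycle) (a : DoubleCone s),
          z.Induces a ρ.endo → (z.map i).Induces a (F.obj ρ).endo) ∧
        (∀ (ρ : A.Tt) (a : DoubleCone s),
          A.LocalizedIn ρ.endo a → B.LocalizedIn (F.obj ρ).endo a) ∧
        -- on arrows: the given inclusion
        (∀ {ρ σ : A.Tt} (T : ρ ⟶ σ), Net.Tt.elem (F.map T) = i.hom (Net.Tt.elem T)) ∧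
        -- an inclusion of categories
        Function.Injective F.obj ∧ F.Faithful ∧
        -- preserving the structure of a C*-category
        F.Additive ∧ F.Linear ℂ ∧
        (∀ {ρ σ : A.Tt} (T : ρ ⟶ σ), F.map (Net.Tt.adjoint T) = Net.Tt.adjoint (F.map T)) ∧
        (∀ {ρ σ : A.Tt} (T : ρ ⟶ σ), ‖F.map T‖ = ‖T‖) ∧
        -- strictly preserving the tensor structure
        (∀ ρ σ : A.Tt, F.obj (ρ ⊗ σ) = F.obj ρ ⊗ F.obj σ) ∧
        F.obj (𝟙_ A.Tt) = 𝟙_ B.Tt ∧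
        (∀ {ρ ρ' σ σ' : A.Tt} (S : ρ ⟶ ρ') (T : σ ⟶ σ'),
          Net.Tt.elem (F.map (S ⊗ₘ T)) = Net.Tt.elem (F.map S ⊗ₘ F.map T)) ∧
        (∀ ρ σ : A.Tt, Net.Tt.elem (Functor.LaxMonoidal.μ F ρ σ) = 1) ∧
        Net.Tt.elem (Functor.LaxMonoidal.ε F) = 1 ∧
        -- and the permutation symmetry
        (∀ ρ σ : A.Tt, i.hom (Net.Tt.elem (εA.braiding ρ σ).hom) =
          Net.Tt.elem (εB.braiding (F.obj ρ) (F.obj σ)).hom) := by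
  exact ⟨fun z a => (z.exists_induces hs hA a).elim fun ρ hρ =>
      ⟨⟨ρ, ⟨a, hρ.localizedIn⟩, hρ.transportable⟩, hρ.localizedIn, hρ⟩,
    fun ρ a ha => ρ.transportable.exists_induces hA ha,
    Net.Tt.canonicalSymmetry hs hA, Net.Tt.canonicalSymmetry hs hB,
    Net.Tt.isCanonicalSymmetry_canonicalSymmetry hs hA,
    Net.Tt.isCanonicalSymmetry_canonicalSymmetry hs hB,
    i.extension hs hA hB, i.extensionBraided hs hA hB,
    i.extension_obj_endo_hom hs hA hB,
    fun ρ _ _ hz => (i.isExtension_extension_obj hs hA hB ρ).induces hz,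
    fun ρ _ ha => (i.isExtension_extension_obj hs hA hB ρ).localizedIn ha,
    i.elem_extension_map hs hA hB, i.extension_obj_injective hs hA hB, inferInstance,
    inferInstance, inferInstance, i.extension_map_adjoint hs hA hB,
    i.norm_extension_map hs hA hB, i.extension_obj_tensor hs hA hB,
    i.extension_obj_unit hs hA hB, i.elem_extension_map_tensorHom hs hA hB,
    fun _ _ => rfl, rfl, i.hom_permutation hs hA hB⟩
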